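/- Let $$\operatorname{erf}(x)=\frac{2}{\sqrt\pi}\int_0^x e^{-s^2}\,ds,\qquad \Psi(x)=\frac{1}{2x^3}\Big[\operatorname{erf}(x)-\frac{2}{\sqrt\pi}\,x e^{-x^2}\Big],\qquad w(x)=x^2e^{-x^2}\qquad(x>0),$$ and, for $\lambda\in\mathbb{C}\setminus\{0\}$, let $$P_0(x)=1+\frac{1}{8x\lambda}+\frac{5}{128x^2\lambda^2}+\frac{15}{1024x^3\lambda^3},$$ $$P_1(x)=1-\frac{5}{12x\lambda}-\frac{5}{32x^2\lambda^2}+\frac{5}{128x^3\lambda^3}+\frac{25}{6144x^4\lambda^4}+\frac{7-1152\lambda^4}{8192x^5\lambda^5}.$$ (a) For every $\lambda\in\mathbb{C}\setminus\{0\}$ the equation $-(\Psi w u')'=\lambda w u$ has two linearly independent solutions $u_+,u_-:(0,\infty)\to\mathbb{C}$ such that $$u_\pm(x)=x^{-1/4}e^{x^2/2}P_0(x)\exp\Big\{\pm i\sqrt{\tfrac{8\lambda}{25}}\,P_1(x)\,x^{5/2}\Big\}\big[1+O(x^{-7/2})\big]\qquad(x\to\infty),$$ where $\sqrt{\cdot}$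 is the principal square root (equal to $i\sqrt{|\cdot|}$ on the negative real axis). (b) Let $\lambda>0$ and let $u$ be a real-valued solution of $-(\Psi w u')'=\lambda w u$ on an interval $(R,\infty)$, $R\ge0$. Then there are constants $C,\theta\in\mathbb{R}$ such that $y(x)=xe^{-x^2/2}u(x)$ satisfies $$y(x)=C\,x^{3/4}P_0(x)\cos\Big\{\sqrt{\tfrac{8\lambda}{25}}\,P_1(x)\,x^{5/2}-\theta\Big\}+O(x^{-11/4})\qquad(x\to\infty).$$ The pair $(C,\theta)$ is determined by $u$ in the sense that $Ce^{i\theta}$ is the same for all such pairs, and $C\neq0$ unless $u$ vanishes identically on $(R,\infty)$. -/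

import Mathlib

open Filter Asymptotics

namespace ChandrasekharODE

noncomputable section

/-- The error function `erf x = (2 / √π) ∫₀ˣ exp (-s²) ds`. -/
def erf (x : ℝ) : ℝ :=
  2 / Real.sqrt Real.pi * ∫ s in (0 : ℝ)..x, Real.exp (-s ^ 2)

/-- `Ψ(x) = [erf x - (2 / √π) x exp (-x²)] / (2 x³)`; it is only used for `x > 0`. -/
def Psi (x : ℝ) : ℝ :=
  1 / (2 * x ^ 3) * (erf x - 2 / Real.sqrt Real.pi * x * Real.exp (-x ^ 2))

/-- The weight `w(x) = x² exp (-x²)`. -/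
def weight (x : ℝ) : ℝ := x ^ 2 * Real.exp (-x ^ 2)

/-- `u` is a (real- or complex-valued) classical solution of `-(Ψ w u')' = lam w u` on `(R, ∞)`.
The values of `u` outside `(R, ∞)` play no role. -/
def IsSolution {𝕜 : Type*} [RCLike 𝕜] (lam : 𝕜) (R : ℝ) (u : ℝ → 𝕜) : Prop :=
  ∀ x : ℝ, R < x →
    DifferentiableAt ℝ u x ∧
    DifferentiableAt ℝ (fun t => ((Psi t * weight t : ℝ) : 𝕜) * deriv u t) x ∧
    -deriv (fun t => ((Psi t * weight t : ℝ) : 𝕜) * deriv u t) x = lam * (weight x : 𝕜) * u x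

/-- `P₀(x) = 1 + 1/(8xλ) + 5/(128x²λ²) + 15/(1024x³λ³)`. -/
def P0 {𝕜 : Type*} [Field 𝕜] (lam x : 𝕜) : 𝕜 :=
  1 + 1 / (8 * x * lam) + 5 / (128 * x ^ 2 * lam ^ 2) + 15 / (1024 * x ^ 3 * lam ^ 3)

/-- `P₁(x) = 1 - 5/(12xλ) - 5/(32x²λ²) + 5/(128x³λ³) + 25/(6144x⁴λ⁴)
+ (7 - 1152λ⁴)/(8192x⁵λ⁵)`. -/
def P1 {𝕜 : Type*} [Field 𝕜] (lam x : 𝕜) : 𝕜 :=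
  1 - 5 / (12 * x * lam) - 5 / (32 * x ^ 2 * lam ^ 2) + 5 / (128 * x ^ 3 * lam ^ 3)
    + 25 / (6144 * x ^ 4 * lam ^ 4) + (7 - 1152 * lam ^ 4) / (8192 * x ^ 5 * lam ^ 5)

/-- `x^(-1/4) exp(x²/2) P₀(x) exp (σ i √(8λ/25) P₁(x) x^(5/2))`, principal square root,
with `σ = 1` or `σ = -1`. -/
def mode (lam σ : ℂ) (x : ℝ) : ℂ :=
  ((x ^ (-(1 / 4) : ℝ) * Real.exp (x ^ 2 / 2) : ℝ) : ℂ) * P0 lam (x : ℂ) *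
    Complex.exp (σ * Complex.I * Complex.sqrt (8 * lam / 25) * P1 lam (x : ℂ) *
      ((x ^ (5 / 2 : ℝ) : ℝ) : ℂ))

/-- `u(x) = mode(x) [1 + O(x^(-7/2))]` as `x → ∞`. -/
def HasModeForm (lam σ : ℂ) (u : ℝ → ℂ) : Prop :=
  ∃ ε : ℝ → ℂ, ε =O[atTop] (fun x : ℝ => x ^ (-(7 / 2) : ℝ)) ∧
    ∀ᶠ x : ℝ in atTop, u x = mode lam σ x * (1 + ε x)

/-- The rescaled variable `y(x) = x exp(-x²/2) u(x)`. -/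
def yVar (u : ℝ → ℝ) (x : ℝ) : ℝ := x * Real.exp (-x ^ 2 / 2) * u x

/-- `y(x) = C x^(3/4) P₀(x) cos (√(8λ/25) P₁(x) x^(5/2) - θ) + O(x^(-11/4))` as `x → ∞`. -/
def HasCosForm (lam C θ : ℝ) (y : ℝ → ℝ) : Prop :=
  (fun x : ℝ => y x - C * x ^ (3 / 4 : ℝ) * P0 lam x *
      Real.cos (Real.sqrt (8 * lam / 25) * P1 lam x * x ^ (5 / 2 : ℝ) - θ))
    =O[atTop] (fun x : ℝ => x ^ (-(11 / 4) : ℝ))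

end

end ChandrasekharODE

/-! The proof is a WKB approximation followed by variation of constants. Put p = Ψ w and write the
equation as u' = f / p, f' = -λ w u. Since erf x tends to 1 faster than any power, p'/p is -2x - 1/x
and w/p is 2x³ up to negligible errors. Let z₊, z₋ be the explicit functions `mode lam 1`, `mode lam
(-1)`, and put μ = 1/λ, q = 1/x. Their phase φ has derivative √(8λ/25) (5/2) x^(3/2) D(q), where D²
agrees with 1 - μq/2 + 9μq⁵/32 up to O(q⁶) (`freqPoly_sq`) and P₀ agrees with D^(-1/2) up to O(q⁴)
(`freqPoly_mul_ampPoly_sq`). With `transport_eq` it follows that z₊, z₋ satisfy the equation up to a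
relative residual O(x^(-3)) (`residual_isBigO`), and that their Wronskian tends to k = (5/2) i
√(8λ/25) with error O(x^(-7/2)). Variation of constants divides the residual by φ', of order
x^(3/2). The quotient O(x^(-9/2)) is integrable, and its tail is the error O(x^(-7/2)) of the
theorem.

How this becomes a statement about solutions depends on r = √(8λ/25). If Im r > 0, then z₊/z₋ =
exp(2iφ) decays exponentially. A solution that agrees with z₋ far out stays comparable to it
(`exists_dominant`), and reduction of order gives the decaying one (`exists_recessive`). The case Im
r < 0 is its complex conjugate. If r is real, then λ > 0 and |z₊/z₋| = 1. The brackets of any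
solution with z₊ and z₋ converge, and both limits vanish only for the zero solution
(`exists_bracket_limit`). The space of solutions is two-dimensional, so all pairs of limits occur.

For (b), a real solution is a real amplitude times α e^(iφ) + β e^(-iφ) + O(x^(-7/2)). Since φ is
continuous and unbounded, reality forces α = conj β, which is the cosine form. The same oscillation
argument, `eq_zero_of_tendsto_re`, gives uniqueness of C e^(iθ). -/

namespace ChandrasekharODE

open Set Topology MeasureTheory
open scoped ComplexConjugate

/-! ### Linear differential equations -/

section LinearODE

variable {E : Type*} [NormedAddCommGroup E] [NormedSpace ℝ E]

/-- The successive approximations to the solution of `U' = A U`, `U 0 = U₀`. -/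
noncomputable def picardTerm (A : ℝ → E →L[ℝ] E) (U₀ : E) : ℕ → ℝ → E
  | 0 => fun _ => U₀
  | n + 1 => fun t => ∫ s in (0 : ℝ)..t, A s (picardTerm A U₀ n s)

theorem continuous_picardTerm {A : ℝ → E →L[ℝ] E} (hA : Continuous A) (U₀ : E) (n : ℕ) :
    Continuous (picardTerm A U₀ n) := by
  induction n with
  | zero => exact continuous_const
  | succ n ih =>
    exact intervalIntegral.continuous_primitive
      (fun a b => (hA.clm_apply ih).intervalIntegrable a b) 0

theorem hasDerivAt_picardTerm_succ [CompleteSpace E] {A : ℝ → E →L[ℝ] E} (hA : Continuous A) (U₀ : E) (n : ℕ)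
    (t : ℝ) : HasDerivAt (picardTerm A U₀ (n + 1)) (A t (picardTerm A U₀ n t)) t := by
  have hc : Continuous fun s => A s (picardTerm A U₀ n s) :=
    hA.clm_apply (continuous_picardTerm hA U₀ n)
  exact intervalIntegral.integral_hasDerivAt_right (hc.intervalIntegrable _ _)
    (hc.stronglyMeasurableAtFilter _ _) hc.continuousAt

/-- Each integration of the bound on `A` gains a factor M |t| / (n + 1). The resulting exponential
series dominates both the Picard series and its termwise derivative. -/
theorem norm_picardTerm_le {A : ℝ → E →L[ℝ] E} (U₀ : E) {T M : ℝ}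
    (hM : ∀ t ∈ Icc (-T) T, ‖A t‖ ≤ M) (n : ℕ) :
    ∀ t ∈ Icc (-T) T, ‖picardTerm A U₀ n t‖ ≤ ‖U₀‖ * (M * |t|) ^ n / n.factorial := by
  induction n with
  | zero => intro t _; simp [picardTerm]
  | succ n ih =>
    intro t ht
    have hsub : ∀ s ∈ uIcc 0 t, s ∈ Icc (-T) T := by
      intro s hs
      have h0 : (0 : ℝ) ∈ Icc (-T) T := ⟨by linarith [ht.1, ht.2], by linarith [ht.1, ht.2]⟩
      exact (convex_Icc (-T) T).ordConnected.uIcc_subset h0 ht hs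
    have hM0 : 0 ≤ M := (norm_nonneg _).trans (hM t ht)
    have key : ∀ s ∈ uIcc 0 t, ‖A s (picardTerm A U₀ n s)‖ ≤
        ‖U₀‖ * M ^ (n + 1) / n.factorial * |s| ^ n := by
      intro s hs
      calc ‖A s (picardTerm A U₀ n s)‖ ≤ ‖A s‖ * ‖picardTerm A U₀ n s‖ :=
            (A s).le_opNorm _
        _ ≤ M * (‖U₀‖ * (M * |s|) ^ n / n.factorial) :=
            mul_le_mul (hM s (hsub s hs)) (ih s (hsub s hs)) (norm_nonneg _) hM0
        _ = _ := by rw [mul_pow]; ring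
    have hint : ‖∫ s in (0 : ℝ)..t, A s (picardTerm A U₀ n s)‖ ≤
        |∫ s in (0 : ℝ)..t, ‖U₀‖ * M ^ (n + 1) / n.factorial * |s| ^ n| := by
      apply intervalIntegral.norm_integral_le_abs_of_norm_le
      · exact (ae_restrict_iff' measurableSet_uIoc).2
          (ae_of_all _ fun s hs => key s (uIoc_subset_uIcc hs))
      · exact (by fun_prop : Continuous fun s : ℝ =>
          ‖U₀‖ * M ^ (n + 1) / n.factorial * |s| ^ n).intervalIntegrable _ _
    refine hint.trans (le_of_eq ?_)
    rw [intervalIntegral.integral_const_mul, abs_mul]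
    have h1 : |∫ s in (0 : ℝ)..t, |s| ^ n| = |t| ^ (n + 1) / (n + 1) := by
      rcases le_total 0 t with h | h
      · have : ∫ s in (0 : ℝ)..t, |s| ^ n = ∫ s in (0 : ℝ)..t, s ^ n := by
          apply intervalIntegral.integral_congr
          intro s hs
          rw [uIcc_of_le h] at hs
          simp [abs_of_nonneg hs.1]
        rw [this, integral_pow, abs_of_nonneg h]
        rw [abs_of_nonneg]
        · simp
        · simp; positivity
      · have : ∫ s in (0 : ℝ)..t, |s| ^ n = ∫ s in (0 : ℝ)..t, (-s) ^ n := by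
          apply intervalIntegral.integral_congr
          intro s hs
          rw [uIcc_of_ge h] at hs
          simp [abs_of_nonpos hs.2]
        rw [this, intervalIntegral.integral_comp_neg (fun s => s ^ n), integral_pow,
          abs_of_nonpos h]
        have h' : (0 : ℝ) ≤ (-t) ^ (n + 1) := pow_nonneg (by linarith) _
        rw [abs_of_nonpos]
        · simp; ring
        · simp only [neg_zero]
          apply div_nonpos_of_nonpos_of_nonneg
          · simp; exact h'
          · positivity
    rw [h1, abs_of_nonneg (by positivity), Nat.factorial_succ]
    push_cast
    rw [mul_pow]
    field_simp

/-- A linear differential equation with continuous coefficients on `ℝ` has global solutions. -/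
theorem exists_forall_hasDerivAt_linear [CompleteSpace E] {A : ℝ → E →L[ℝ] E} (hA : Continuous A) (U₀ : E) :
    ∃ U : ℝ → E, U 0 = U₀ ∧ ∀ t, HasDerivAt U (A t (U t)) t := by
  have hsummable : ∀ M T : ℝ, Summable fun n : ℕ => ‖U₀‖ * (M * T) ^ n / n.factorial := by
    intro M T
    simp_rw [mul_div_assoc]
    exact (Real.summable_pow_div_factorial _).mul_left _
  have hbd : ∀ T : ℝ, ∃ M, ∀ t ∈ Icc (-T) T, ‖A t‖ ≤ M := fun T =>
    isCompact_Icc.exists_bound_of_continuousOn hA.continuousOn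
  have hbound : ∀ T M : ℝ, (∀ t ∈ Icc (-T) T, ‖A t‖ ≤ M) → ∀ t ∈ Icc (-T) T, ∀ n,
      ‖picardTerm A U₀ n t‖ ≤ ‖U₀‖ * (M * T) ^ n / n.factorial := by
    intro T M hM t ht n
    refine (norm_picardTerm_le U₀ hM n t ht).trans ?_
    have hM0 : 0 ≤ M := (norm_nonneg _).trans (hM t ht)
    have : |t| ≤ T := abs_le.2 ht
    gcongr
  have hsum : ∀ t, Summable fun n => picardTerm A U₀ n t := by
    intro t
    obtain ⟨M, hM⟩ := hbd |t|
    exact Summable.of_norm_bounded (hsummable M |t|)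
      (hbound |t| M hM t ⟨neg_abs_le t, le_abs_self t⟩)
  refine ⟨fun t => ∑' n, picardTerm A U₀ n t, ?_, ?_⟩
  · change ∑' n, picardTerm A U₀ n 0 = U₀
    rw [tsum_eq_single 0]
    · rfl
    · intro n hn
      obtain ⟨m, rfl⟩ := Nat.exists_eq_succ_of_ne_zero hn
      simp [picardTerm]
  · intro t
    -- The constant zeroth term is split off because the derivative of term n + 1 is `A` applied to
    -- term n: differentiating the shifted series reproduces the whole series under `A`.
    have h1 : (fun t => ∑' n, picardTerm A U₀ n t) =
        fun t => U₀ + ∑' n, picardTerm A U₀ (n + 1) t := by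
      funext t
      rw [(hsum t).tsum_eq_zero_add]
      rfl
    have h2 : A t (∑' n, picardTerm A U₀ n t) = ∑' n, A t (picardTerm A U₀ n t) :=
      (A t).map_tsum (hsum t)
    change HasDerivAt (fun t => ∑' n, picardTerm A U₀ n t) (A t (∑' n, picardTerm A U₀ n t)) t
    rw [h2, h1]
    apply HasDerivAt.const_add
    obtain ⟨M, hM⟩ := hbd (|t| + 1)
    have hmem : ∀ y ∈ Ioo (-(|t| + 1)) (|t| + 1), y ∈ Icc (-(|t| + 1)) (|t| + 1) :=
      fun y hy => Ioo_subset_Icc_self hy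
    have ht : t ∈ Ioo (-(|t| + 1)) (|t| + 1) :=
      ⟨by linarith [neg_abs_le t], by linarith [le_abs_self t]⟩
    have hs1 : Summable fun n => picardTerm A U₀ (n + 1) t :=
      (summable_nat_add_iff (f := fun n => picardTerm A U₀ n t) 1).2 (hsum t)
    have hs2 : Summable fun n : ℕ => M * (‖U₀‖ * (M * (|t| + 1)) ^ n / n.factorial) :=
      (hsummable M (|t| + 1)).mul_left M
    refine hasDerivAt_tsum_of_isPreconnected (𝕜 := ℝ) (t := Ioo (-(|t| + 1)) (|t| + 1)) (y₀ := t)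
      (g := fun n => picardTerm A U₀ (n + 1)) (g' := fun n y => A y (picardTerm A U₀ n y))
      (u := fun n => M * (‖U₀‖ * (M * (|t| + 1)) ^ n / n.factorial))
      hs2 isOpen_Ioo isPreconnected_Ioo
      (fun n y _ => hasDerivAt_picardTerm_succ hA U₀ n y) ?_ ht
      hs1 ht
    intro n y hy
    refine ((A y).le_opNorm _).trans ?_
    exact mul_le_mul (hM y (hmem y hy)) (hbound _ M hM y (hmem y hy) n) (norm_nonneg _)
      ((norm_nonneg _).trans (hM y (hmem y hy)))

/-- Solutions of a linear differential equation on a half-line are determined by one value. -/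
theorem eq_zero_of_hasDerivAt_linear {A : ℝ → E →L[ℝ] E} {R : ℝ} (hA : ContinuousOn A (Ioi R))
    {U : ℝ → E} (hU : ∀ x, R < x → HasDerivAt U (A x (U x)) x) {x₀ : ℝ} (hx₀ : R < x₀)
    (h0 : U x₀ = 0) {x : ℝ} (hx : R < x) : U x = 0 := by
  -- The coefficients may be unbounded near R, so the left end of the compact interval lies strictly
  -- between R and both points. Boundedness there supplies the Lipschitz constant.
  set m := (R + min x x₀) / 2 with hm
  have hmin : R < min x x₀ := lt_min hx hx₀
  have hRm : R < m := by rw [hm]; linarith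
  have hmx : m < min x x₀ := by rw [hm]; linarith
  set M := max x x₀ + 1
  have hsub : Icc m M ⊆ Ioi R := fun y hy => hRm.trans_le hy.1
  obtain ⟨K, hK⟩ := (isCompact_Icc (a := m) (b := M)).exists_bound_of_continuousOn (hA.mono hsub)
  have hmem : ∀ y, min x x₀ ≤ y → y ≤ max x x₀ → y ∈ Ioo m M := fun y h1 h2 =>
    ⟨hmx.trans_le h1, by simp only [M]; linarith⟩
  have hx₀' := hmem x₀ (min_le_right _ _) (le_max_right _ _)
  have hx' := hmem x (min_le_left _ _) (le_max_left _ _)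
  have := ODE_solution_unique_of_mem_Ioo (v := fun t y => A t y) (s := fun _ => univ)
    (K := K.toNNReal) (f := U) (g := fun _ => 0) (t₀ := x₀) (a := m) (b := M) ?_ hx₀' ?_ ?_ ?_
  · exact this hx'
  · intro t ht
    refine (((A t).lipschitz).weaken ?_).lipschitzOnWith
    rw [← NNReal.coe_le_coe, coe_nnnorm]
    exact (hK t (Ioo_subset_Icc_self ht)).trans (Real.le_coe_toNNReal K)
  · intro t ht
    exact ⟨hU t (hRm.trans ht.1), mem_univ _⟩
  · intro t ht
    simpa using hasDerivAt_const t (0 : E)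
  · simpa using h0

end LinearODE

/-! ### Functions with integrable derivatives -/

section Decay

variable {E : Type*} [NormedAddCommGroup E] [NormedSpace ℝ E]

/-- Mean value inequality on `[X, Y]` with two-sided derivatives. -/
theorem norm_sub_le_of_hasDerivAt {h h' : ℝ → E} {B B' : ℝ → ℝ} {X Y : ℝ} (hXY : X ≤ Y)
    (hh : ∀ x ∈ Icc X Y, HasDerivAt h (h' x) x) (hB : ∀ x ∈ Icc X Y, HasDerivAt B (B' x) x)
    (hle : ∀ x ∈ Icc X Y, ‖h' x‖ ≤ B' x) : ‖h Y - h X‖ ≤ B Y - B X := by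
  have := image_norm_le_of_norm_deriv_right_le_deriv_boundary' (f := fun x => h x - h X)
    (f' := h') (a := X) (b := Y) (B := fun x => B x - B X) (B' := B')
    (fun x hx => ((hh x hx).sub_const _).continuousAt.continuousWithinAt)
    (fun x hx => ((hh x (Ico_subset_Icc_self hx)).sub_const _).hasDerivWithinAt)
    (by simp)
    (fun x hx => ((hB x hx).sub_const _).continuousAt.continuousWithinAt)
    (fun x hx => ((hB x (Ico_subset_Icc_self hx)).sub_const _).hasDerivWithinAt)
    (fun x hx => hle x (Ico_subset_Icc_self hx))
  exact this (right_mem_Icc.2 hXY)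

theorem hasDerivAt_neg_rpow_div {C s x : ℝ} (hs : 0 < s) (hx : 0 < x) :
    HasDerivAt (fun x : ℝ => -(C / s * x ^ (-s))) (C * x ^ (-s - 1)) x := by
  have := (((Real.hasDerivAt_rpow_const (p := -s) (Or.inl hx.ne')).const_mul (C / s))).fun_neg
  refine this.congr_deriv ?_
  have h1 := hs.ne'
  field_simp

theorem norm_sub_le_rpow {h h' : ℝ → E} {C s X Y : ℝ} (hs : 0 < s) (hX : 0 < X) (hXY : X ≤ Y)
    (hh : ∀ x ∈ Icc X Y, HasDerivAt h (h' x) x)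
    (hle : ∀ x ∈ Icc X Y, ‖h' x‖ ≤ C * x ^ (-s - 1)) :
    ‖h Y - h X‖ ≤ C / s * (X ^ (-s) - Y ^ (-s)) := by
  refine (norm_sub_le_of_hasDerivAt hXY hh
    (fun x hx => hasDerivAt_neg_rpow_div (C := C) hs (hX.trans_le hx.1)) hle).trans
    (le_of_eq ?_)
  ring

/-- A function whose increments beyond `x` are at most `β x → 0` converges at infinity. -/
theorem exists_tendsto_of_increment_le {E : Type*} [NormedAddCommGroup E] [CompleteSpace E]
    {h : ℝ → E} {β : ℝ → ℝ} {X : ℝ} (hβ : Tendsto β atTop (𝓝 0))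
    (hd : ∀ x y, X ≤ x → x ≤ y → ‖h y - h x‖ ≤ β x) :
    ∃ l : E, Tendsto h atTop (𝓝 l) ∧ ∀ x, X ≤ x → ‖h x - l‖ ≤ β x := by
  have hcauchy : Cauchy (map h atTop) := by
    rw [Metric.cauchy_iff]
    refine ⟨inferInstance, fun ε hε => ?_⟩
    obtain ⟨x, hx1, hx2⟩ := ((hβ.eventually (gt_mem_nhds (half_pos hε))).and
      (eventually_ge_atTop X)).exists
    refine ⟨h '' Ici x, image_mem_map (Ici_mem_atTop x), ?_⟩
    rintro _ ⟨a, ha, rfl⟩ _ ⟨b, hb, rfl⟩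
    have h1 := hd x a hx2 ha
    have h2 := hd x b hx2 hb
    calc dist (h a) (h b) ≤ dist (h a) (h x) + dist (h b) (h x) := dist_triangle_right _ _ _
      _ < ε := by rw [dist_eq_norm, dist_eq_norm]; linarith
  obtain ⟨l, hl⟩ := CompleteSpace.complete hcauchy
  refine ⟨l, hl, fun x hx => ?_⟩
  have h1 : Tendsto (fun y => ‖h x - h y‖) atTop (𝓝 ‖h x - l‖) :=
    (tendsto_const_nhds.sub hl).norm
  refine le_of_tendsto h1 ?_
  filter_upwards [eventually_ge_atTop x] with y hy
  rw [norm_sub_rev]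
  exact hd x y hx hy

/-- If `h' = O(x ^ (-s - 1))`, then `h` converges at infinity with rate `x ^ (-s)`. -/
theorem exists_tendsto_of_deriv_le_rpow [CompleteSpace E] {h h' : ℝ → E} {C s X : ℝ} (hs : 0 < s)
    (hX : 0 < X) (hh : ∀ x, X ≤ x → HasDerivAt h (h' x) x)
    (hle : ∀ x, X ≤ x → ‖h' x‖ ≤ C * x ^ (-s - 1)) :
    ∃ l : E, Tendsto h atTop (𝓝 l) ∧ ∀ x, X ≤ x → ‖h x - l‖ ≤ C / s * x ^ (-s) := by
  have hC : 0 ≤ C := by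
    have := (norm_nonneg _).trans (hle X le_rfl)
    exact nonneg_of_mul_nonneg_left this (Real.rpow_pos_of_pos hX _)
  refine exists_tendsto_of_increment_le
    (by simpa using (tendsto_rpow_neg_atTop hs).const_mul (C / s)) fun x y hx hxy => ?_
  have := norm_sub_le_rpow hs (hX.trans_le hx) hxy (fun t ht => hh t (hx.trans ht.1))
    (fun t ht => hle t (hx.trans ht.1))
  refine this.trans ?_
  have : 0 ≤ y ^ (-s) := Real.rpow_nonneg (hX.le.trans (hx.trans hxy)) _
  gcongr
  linarith

end Decay

/-! ### A bootstrap estimate for quantities controlled by their own past -/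

/-- A continuous function whose increments over `[X, Y]` are controlled by a quarter of its
supremum stays close to its initial value. -/
theorem norm_sub_le_half_of_increment {E : Type*} [NormedAddCommGroup E] {h : ℝ → E} {X : ℝ} (hc : ContinuousOn h (Ici X))
    (hinc : ∀ Y N : ℝ, X ≤ Y → (∀ x ∈ Icc X Y, ‖h x‖ ≤ N) → ‖h Y - h X‖ ≤ N / 4) {x : ℝ}
    (hx : X ≤ x) : ‖h x - h X‖ ≤ ‖h X‖ / 2 := by
  -- At a point m where ‖h‖ is maximal the hypothesis bounds ‖h m‖ by (4/3) ‖h X‖. Applied again at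
  -- x, it bounds the increment by a third of ‖h X‖.
  obtain ⟨m, hm, hmax⟩ := (isCompact_Icc (a := X) (b := x)).exists_isMaxOn
    ⟨X, left_mem_Icc.2 hx⟩ ((hc.mono Icc_subset_Ici_self).norm)
  have h1 := hinc m ‖h m‖ hm.1 fun y hy => hmax ⟨hy.1, hy.2.trans hm.2⟩
  have h2 := hinc x ‖h m‖ hx fun y hy => hmax hy
  have h3 : ‖h m‖ ≤ ‖h m - h X‖ + ‖h X‖ := by simpa using norm_add_le (h m - h X) (h X)
  linarith [norm_nonneg (h X)]

/-- If `h'` is bounded by `x ^ (-s - 1)` times the past supremum of `h`, with a small constant,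
then `h` has a limit close to its initial value. -/
theorem exists_tendsto_of_deriv_le_past {E : Type*} [NormedAddCommGroup E] [NormedSpace ℝ E]
    [CompleteSpace E] {h h' : ℝ → E} {C s X : ℝ} (hs : 0 < s) (hX : 0 < X) (hC : 0 ≤ C)
    (hsmall : C / s * X ^ (-s) ≤ 1 / 4) (hh : ∀ x, X ≤ x → HasDerivAt h (h' x) x)
    (hle : ∀ Y N : ℝ, X ≤ Y → (∀ x ∈ Icc X Y, ‖h x‖ ≤ N) → ‖h' Y‖ ≤ C * N * Y ^ (-s - 1)) :
    ∃ l : E, Tendsto h atTop (𝓝 l) ∧ (fun x => h x - l) =O[atTop] (fun x : ℝ => x ^ (-s)) ∧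
      ‖l - h X‖ ≤ ‖h X‖ / 2 := by
  have hc : ContinuousOn h (Ici X) := fun x hx => (hh x hx).continuousAt.continuousWithinAt
  have hhalf : ∀ x, X ≤ x → ‖h x - h X‖ ≤ ‖h X‖ / 2 := by
    intro x hx
    refine norm_sub_le_half_of_increment hc (fun Y N hXY hN => ?_) hx
    have hN0 : 0 ≤ N := (norm_nonneg _).trans (hN X (left_mem_Icc.2 hXY))
    refine (norm_sub_le_rpow hs hX hXY (fun t ht => hh t ht.1) (C := C * N)
      fun t ht => hle t N ht.1 fun y hy => hN y ⟨hy.1, hy.2.trans ht.2⟩).trans ?_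
    have hY : 0 ≤ Y ^ (-s) := Real.rpow_nonneg (hX.le.trans hXY) _
    calc C * N / s * (X ^ (-s) - Y ^ (-s)) ≤ C * N / s * X ^ (-s) := by
          gcongr
          linarith
      _ = (C / s * X ^ (-s)) * N := by ring
      _ ≤ 1 / 4 * N := by gcongr
      _ = N / 4 := by ring
  have hbd : ∀ x, X ≤ x → ‖h x‖ ≤ 3 / 2 * ‖h X‖ := by
    intro x hx
    have h1 := hhalf x hx
    have h2 : ‖h x‖ ≤ ‖h x - h X‖ + ‖h X‖ := by simpa using norm_add_le (h x - h X) (h X)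
    linarith
  obtain ⟨l, hl, hrate⟩ := exists_tendsto_of_deriv_le_rpow hs hX hh
    fun x hx => hle x (3 / 2 * ‖h X‖) hx fun y hy => hbd y hy.1
  refine ⟨l, hl, IsBigO.of_bound (C * (3 / 2 * ‖h X‖) / s) ?_, ?_⟩
  · filter_upwards [eventually_ge_atTop X] with x hx
    rw [Real.norm_of_nonneg (Real.rpow_nonneg (hX.le.trans hx) _)]
    exact hrate x hx
  · refine le_of_tendsto (hl.sub_const _).norm ?_
    filter_upwards [eventually_ge_atTop X] with x hx using hhalf x hx

/-- A bound `C x ^ (-s)` is eventually small. -/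
theorem eventually_mul_rpow_neg_le (C : ℝ) {s ε : ℝ} (hs : 0 < s) (hε : 0 < ε) :
    ∀ᶠ x : ℝ in atTop, C * x ^ (-s) ≤ ε := by
  have h : Tendsto (fun x : ℝ => C * x ^ (-s)) atTop (𝓝 0) := by
    simpa using (tendsto_rpow_neg_atTop hs).const_mul C
  exact (h.eventually (gt_mem_nhds hε)).mono fun x hx => hx.le

/-! ### The coefficients -/

theorem hasDerivAt_erf (x : ℝ) :
    HasDerivAt erf (2 / Real.sqrt Real.pi * Real.exp (-x ^ 2)) x := by
  have hc : Continuous fun s : ℝ => Real.exp (-s ^ 2) := by fun_prop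
  exact (intervalIntegral.integral_hasDerivAt_right (hc.intervalIntegrable 0 x)
    (hc.stronglyMeasurableAtFilter _ _) hc.continuousAt).const_mul _

theorem tendsto_erf : Tendsto erf atTop (𝓝 1) := by
  have hi : IntegrableOn (fun s : ℝ => Real.exp (-s ^ 2)) (Ioi 0) := by
    have := (integrable_exp_neg_mul_sq (b := 1) one_pos).integrableOn (s := Ioi 0)
    simpa using this
  have h := (intervalIntegral_tendsto_integral_Ioi 0 hi tendsto_id).const_mul
    (2 / Real.sqrt Real.pi)
  have h2 : ∫ s in Ioi (0 : ℝ), Real.exp (-s ^ 2) = Real.sqrt Real.pi / 2 := by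
    have := integral_gaussian_Ioi 1
    simpa using this
  rw [h2] at h
  have h3 : 2 / Real.sqrt Real.pi * (Real.sqrt Real.pi / 2) = 1 := by
    have : Real.sqrt Real.pi ≠ 0 := (Real.sqrt_pos.2 Real.pi_pos).ne'
    field_simp
  rw [h3] at h
  exact h

/-- The numerator `erf x - (2 / √π) x exp (-x²)` of `Ψ`. -/
noncomputable def psiNum (x : ℝ) : ℝ := erf x - 2 / Real.sqrt Real.pi * x * Real.exp (-x ^ 2)

/-- The derivative of `psiNum`. -/
noncomputable def psiNumDeriv (x : ℝ) : ℝ := 4 / Real.sqrt Real.pi * x ^ 2 * Real.exp (-x ^ 2)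

theorem hasDerivAt_psiNum (x : ℝ) : HasDerivAt psiNum (psiNumDeriv x) x := by
  have h1 : HasDerivAt (fun x : ℝ => Real.exp (-x ^ 2)) (Real.exp (-x ^ 2) * (-(2 * x))) x := by
    have := ((hasDerivAt_pow 2 x).fun_neg).exp
    simpa using this
  have h2 := (hasDerivAt_erf x).sub
    (((hasDerivAt_id x).const_mul (2 / Real.sqrt Real.pi)).mul h1)
  refine h2.congr_deriv ?_
  simp only [psiNumDeriv, id]
  ring

/-- The function vanishes at 0 and has positive derivative. Hence Ψ w has no zero on the half-line
and the system is regular there. -/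
theorem psiNum_pos {x : ℝ} (hx : 0 < x) : 0 < psiNum x := by
  have h0 : psiNum 0 = 0 := by simp [psiNum, erf]
  have hmono : StrictMonoOn psiNum (Ici 0) := by
    apply strictMonoOn_of_deriv_pos (convex_Ici 0)
    · exact fun x _ => (hasDerivAt_psiNum x).continuousAt.continuousWithinAt
    · intro x hx
      rw [interior_Ici] at hx
      rw [(hasDerivAt_psiNum x).deriv, psiNumDeriv]
      have : 0 < Real.sqrt Real.pi := Real.sqrt_pos.2 Real.pi_pos
      have hx' : 0 < x := hx
      positivity
  have := hmono (mem_Ici.2 le_rfl) (mem_Ici.2 hx.le) hx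
  rwa [h0] at this

theorem isLittleO_exp_neg_sq (s : ℝ) :
    (fun x : ℝ => Real.exp (-x ^ 2)) =o[atTop] fun x => x ^ s := by
  have h := exp_neg_mul_rpow_isLittleO_exp_neg (b := 1) (p := 2) one_pos (by norm_num)
  have h2 := isLittleO_exp_neg_mul_rpow_atTop (a := 1) one_pos s
  refine (IsBigO.trans_isLittleO ?_ h2)
  refine IsBigO.of_bound 1 ?_
  filter_upwards [eventually_ge_atTop 1] with x hx
  rw [Real.norm_eq_abs, Real.norm_eq_abs, abs_of_pos (Real.exp_pos _),
    abs_of_pos (Real.exp_pos _), one_mul]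
  gcongr
  nlinarith

theorem psiNumDeriv_isBigO (s : ℝ) : psiNumDeriv =O[atTop] fun x : ℝ => x ^ s := by
  have h1 : (fun x : ℝ => x ^ 2 * Real.exp (-x ^ 2)) =O[atTop] fun x : ℝ => x ^ s := by
    have h2 := (isBigO_refl (fun x : ℝ => x ^ 2) atTop).mul (isLittleO_exp_neg_sq (s - 2)).isBigO
    refine h2.trans_eventuallyEq ?_
    filter_upwards [eventually_gt_atTop 0] with x hx
    rw [← Real.rpow_natCast, ← Real.rpow_add hx]
    norm_num
  have := h1.const_mul_left (4 / Real.sqrt Real.pi)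
  refine this.congr_left fun x => ?_
  rw [psiNumDeriv]
  ring

theorem tendsto_psiNum : Tendsto psiNum atTop (𝓝 1) := by
  have h1 : Tendsto (fun x : ℝ => x * Real.exp (-x ^ 2)) atTop (𝓝 0) := by
    have h2 := (isBigO_refl (fun x : ℝ => x) atTop).mul_isLittleO (isLittleO_exp_neg_sq (-1))
    refine ((isLittleO_one_iff ℝ).1 (h2.trans_eventuallyEq ?_))
    filter_upwards [eventually_gt_atTop 0] with x hx
    rw [Real.rpow_neg_one]
    field_simp
  have := tendsto_erf.sub (h1.const_mul (2 / Real.sqrt Real.pi))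
  simp only [mul_zero, sub_zero] at this
  refine this.congr fun x => ?_
  rw [psiNum]
  ring

/-- Integrating the Gaussian-small derivative from infinity shows that replacing erf by 1 costs less
than any power of x, so only powers of 1/x enter the expansion. -/
theorem psiNum_sub_one_isBigO {s : ℝ} (hs : 0 < s) :
    (fun x => psiNum x - 1) =O[atTop] fun x : ℝ => x ^ (-s) := by
  obtain ⟨C, hC⟩ := (psiNumDeriv_isBigO (-s - 1)).bound
  obtain ⟨X, hX⟩ := eventually_atTop.1 hC
  obtain ⟨l, hl, hle⟩ := exists_tendsto_of_deriv_le_rpow (h := psiNum) (h' := psiNumDeriv)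
    (C := C) (X := max X 1) hs (by positivity) (fun x _ => hasDerivAt_psiNum x) (by
      intro x hx
      have := hX x ((le_max_left _ _).trans hx)
      have hx0 : 0 < x := one_pos.trans_le ((le_max_right _ _).trans hx)
      rwa [Real.norm_of_nonneg (Real.rpow_nonneg hx0.le _)] at this)
  obtain rfl := tendsto_nhds_unique hl tendsto_psiNum
  refine IsBigO.of_bound (C / s) ?_
  filter_upwards [eventually_ge_atTop (max X 1)] with x hx
  have hx0 : 0 < x := one_pos.trans_le ((le_max_right _ _).trans hx)
  rw [Real.norm_of_nonneg (Real.rpow_nonneg hx0.le _)]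
  exact hle x hx

/-- The leading coefficient `Ψ w` of the equation. -/
noncomputable def fluxCoeff (x : ℝ) : ℝ := Psi x * weight x

theorem Psi_eq (x : ℝ) : Psi x = psiNum x / (2 * x ^ 3) := by
  rw [Psi, psiNum]
  ring

theorem Psi_pos {x : ℝ} (hx : 0 < x) : 0 < Psi x := by
  rw [Psi_eq]
  have := psiNum_pos hx
  positivity

theorem weight_pos {x : ℝ} (hx : 0 < x) : 0 < weight x := by
  rw [weight]
  positivity

theorem fluxCoeff_pos {x : ℝ} (hx : 0 < x) : 0 < fluxCoeff x :=
  mul_pos (Psi_pos hx) (weight_pos hx)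

theorem fluxCoeff_eq {x : ℝ} (hx : 0 < x) :
    fluxCoeff x = psiNum x * Real.exp (-x ^ 2) / (2 * x) := by
  rw [fluxCoeff, Psi_eq, weight]
  field_simp

theorem hasDerivAt_fluxCoeff {x : ℝ} (hx : 0 < x) :
    HasDerivAt fluxCoeff
      (fluxCoeff x * (-2 * x - 1 / x + psiNumDeriv x / psiNum x)) x := by
  have h1 : HasDerivAt (fun x : ℝ => Real.exp (-x ^ 2)) (Real.exp (-x ^ 2) * (-(2 * x))) x := by
    have := ((hasDerivAt_pow 2 x).fun_neg).exp
    simpa using this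
  have h2 := ((hasDerivAt_psiNum x).mul h1).div ((hasDerivAt_id x).const_mul 2)
    (by simpa using hx.ne')
  have h3 : fluxCoeff =ᶠ[𝓝 x] fun x => psiNum x * Real.exp (-x ^ 2) / (2 * x) := by
    filter_upwards [lt_mem_nhds hx] with y hy using fluxCoeff_eq hy
  refine (h2.congr_of_eventuallyEq h3).congr_deriv ?_
  have := (psiNum_pos hx).ne'
  rw [fluxCoeff_eq hx]
  simp only [id, Pi.mul_apply]
  field_simp
  ring

theorem continuousOn_fluxCoeff : ContinuousOn fluxCoeff (Ioi 0) :=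
  fun _ hx => (hasDerivAt_fluxCoeff hx).continuousAt.continuousWithinAt

theorem continuous_weight : Continuous weight := by
  unfold weight
  fun_prop

/-! ### The equation as a first-order system -/

/-- `(u, f)` solves the system `u' = f / (Ψ w)`, `f' = -lam w u` on `(R, ∞)`. -/
def IsSystemSolution (lam : ℂ) (R : ℝ) (u f : ℝ → ℂ) : Prop :=
  ∀ x : ℝ, R < x → HasDerivAt u (f x / (fluxCoeff x : ℂ)) x ∧
    HasDerivAt f (-(lam * (weight x : ℂ) * u x)) x

theorem IsSystemSolution.linearCombination {lam : ℂ} {R : ℝ} {u₁ f₁ u₂ f₂ : ℝ → ℂ}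
    (h₁ : IsSystemSolution lam R u₁ f₁) (h₂ : IsSystemSolution lam R u₂ f₂) (c₁ c₂ : ℂ) :
    IsSystemSolution lam R (fun x => c₁ * u₁ x + c₂ * u₂ x)
      (fun x => c₁ * f₁ x + c₂ * f₂ x) := by
  intro x hx
  refine ⟨(((h₁ x hx).1.const_mul c₁).add ((h₂ x hx).1.const_mul c₂)).congr_deriv ?_,
    (((h₁ x hx).2.const_mul c₁).add ((h₂ x hx).2.const_mul c₂)).congr_deriv ?_⟩ <;> ring

theorem IsSystemSolution.isSolution {lam : ℂ} {R : ℝ} (hR : 0 ≤ R) {u f : ℝ → ℂ}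
    (h : IsSystemSolution lam R u f) : IsSolution lam R u := by
  intro x hx
  have hev : (fun t => ((Psi t * weight t : ℝ) : ℂ) * deriv u t) =ᶠ[𝓝 x] f := by
    filter_upwards [lt_mem_nhds hx] with t ht
    rw [(h t ht).1.deriv]
    have : (fluxCoeff t : ℂ) ≠ 0 := by exact_mod_cast (fluxCoeff_pos (hR.trans_lt ht)).ne'
    change (fluxCoeff t : ℂ) * _ = _
    field_simp
  have hd := (h x hx).2.congr_of_eventuallyEq hev
  exact ⟨(h x hx).1.differentiableAt, hd.differentiableAt,
    (congrArg Neg.neg hd.deriv).trans (neg_neg _)⟩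

theorem isSystemSolution_of_isSolution_real {lam R : ℝ} (hR : 0 ≤ R) {u : ℝ → ℝ}
    (h : IsSolution lam R u) : IsSystemSolution lam R (fun x => (u x : ℂ))
      (fun x => ((fluxCoeff x * deriv u x : ℝ) : ℂ)) := by
  intro x hx
  obtain ⟨h1, h2, h3⟩ := h x hx
  refine ⟨h1.hasDerivAt.ofReal_comp.congr_deriv ?_, ?_⟩
  · have : (fluxCoeff x : ℂ) ≠ 0 := by exact_mod_cast (fluxCoeff_pos (hR.trans_lt hx)).ne'
    push_cast
    field_simp
  · have h4 := h2.hasDerivAt.ofReal_comp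
    rw [neg_eq_iff_eq_neg.1 h3] at h4
    refine h4.congr_deriv ?_
    simp

/-- The coefficient matrix with off-diagonal entries `c` and `d`. -/
noncomputable def offDiagonal (c d : ℂ) : ℂ × ℂ →L[ℝ] ℂ × ℂ :=
  c • ((ContinuousLinearMap.inl ℝ ℂ ℂ).comp (ContinuousLinearMap.snd ℝ ℂ ℂ)) +
    d • ((ContinuousLinearMap.inr ℝ ℂ ℂ).comp (ContinuousLinearMap.fst ℝ ℂ ℂ))

theorem offDiagonal_apply (c d : ℂ) (z : ℂ × ℂ) : offDiagonal c d z = (c * z.2, d * z.1) := by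
  simp [offDiagonal]

theorem continuousOn_offDiagonal {c d : ℝ → ℂ} {s : Set ℝ} (hc : ContinuousOn c s)
    (hd : ContinuousOn d s) : ContinuousOn (fun t => offDiagonal (c t) (d t)) s := by
  unfold offDiagonal
  fun_prop

/-- The substitution x = X exp t carries the half-line to ℝ, where the coefficients are continuous
and the Picard series gives global solutions. Undoing it accounts for the factor X exp t in both
coefficients. -/
theorem exists_isSystemSolution (lam : ℂ) {X : ℝ} (hX : 0 < X) (u₀ f₀ : ℂ) :
    ∃ u f : ℝ → ℂ, IsSystemSolution lam 0 u f ∧ u X = u₀ ∧ f X = f₀ := by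
  have hpos : ∀ t : ℝ, 0 < X * Real.exp t := fun t => by positivity
  have hp : Continuous fun t => fluxCoeff (X * Real.exp t) :=
    continuousOn_fluxCoeff.comp_continuous (by fun_prop) hpos
  have hc : Continuous fun t =>
      ((X * Real.exp t : ℝ) : ℂ) / (fluxCoeff (X * Real.exp t) : ℂ) := by
    refine (Complex.continuous_ofReal.comp (by fun_prop)).div
      (Complex.continuous_ofReal.comp hp) fun t => ?_
    exact_mod_cast (fluxCoeff_pos (hpos t)).ne'
  have hw : Continuous fun t => weight (X * Real.exp t) := continuous_weight.comp (by fun_prop)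
  have hd : Continuous fun t =>
      -(((X * Real.exp t : ℝ) : ℂ) * (lam * (weight (X * Real.exp t) : ℂ))) := by
    have := Complex.continuous_ofReal.comp hw
    fun_prop
  have hA := continuousOn_offDiagonal (s := univ) hc.continuousOn hd.continuousOn
  rw [continuousOn_univ] at hA
  obtain ⟨U, hU0, hU⟩ := exists_forall_hasDerivAt_linear hA (u₀, f₀)
  have hlog : ∀ x : ℝ, 0 < x → HasDerivAt (fun x => Real.log x - Real.log X) x⁻¹ x :=
    fun x hx => (Real.hasDerivAt_log hx.ne').sub_const _
  have hexp : ∀ x : ℝ, 0 < x → X * Real.exp (Real.log x - Real.log X) = x := by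
    intro x hx
    rw [Real.exp_sub, Real.exp_log hx, Real.exp_log hX]
    field_simp
  refine ⟨fun x => (U (Real.log x - Real.log X)).1, fun x => (U (Real.log x - Real.log X)).2,
    fun x hx => ?_, by simp [hU0], by simp [hU0]⟩
  have h1 := (hU (Real.log x - Real.log X)).scomp x (hlog x hx)
  simp only [offDiagonal_apply, hexp x hx] at h1
  have hxc : (x : ℂ) ≠ 0 := by exact_mod_cast hx.ne'
  refine ⟨((ContinuousLinearMap.fst ℝ ℂ ℂ).hasFDerivAt.comp_hasDerivAt x h1).congr_deriv ?_,
    ((ContinuousLinearMap.snd ℝ ℂ ℂ).hasFDerivAt.comp_hasDerivAt x h1).congr_deriv ?_⟩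
  · simp only [Prod.smul_mk, Complex.real_smul, Complex.ofReal_inv, ContinuousLinearMap.coe_fst']
    field_simp
  · simp only [Prod.smul_mk, Complex.real_smul, Complex.ofReal_inv, ContinuousLinearMap.coe_snd']
    field_simp

theorem IsSystemSolution.eq_zero {lam : ℂ} {R : ℝ} (hR : 0 ≤ R) {u f : ℝ → ℂ}
    (h : IsSystemSolution lam R u f) {x₀ : ℝ} (hx₀ : R < x₀) (hu : u x₀ = 0) (hf : f x₀ = 0)
    {x : ℝ} (hx : R < x) : u x = 0 ∧ f x = 0 := by
  have hA : ContinuousOn (fun t => offDiagonal (1 / (fluxCoeff t : ℂ))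
      (-(lam * (weight t : ℂ)))) (Ioi R) := by
    apply continuousOn_offDiagonal
    · refine continuousOn_const.div (Complex.continuous_ofReal.comp_continuousOn
        (continuousOn_fluxCoeff.mono (Ioi_subset_Ioi hR))) fun t ht => ?_
      exact_mod_cast (fluxCoeff_pos (hR.trans_lt ht)).ne'
    · have := Complex.continuous_ofReal.comp continuous_weight
      exact Continuous.continuousOn (by fun_prop)
  have := eq_zero_of_hasDerivAt_linear hA (U := fun x => (u x, f x)) (fun x hx => by
    rw [offDiagonal_apply]
    refine ((h x hx).1.prodMk (h x hx).2).congr_deriv ?_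
    simp only [Prod.mk.injEq]
    constructor <;> ring) hx₀ (by simp [hu, hf]) hx
  simpa using this

/-! ### The polynomials in `q = 1 / x` -/

/-- `P₀` as a polynomial in `μ = 1 / λ` and `q = 1 / x`. -/
noncomputable def ampPoly (μ q : ℂ) : ℂ :=
  1 + μ / 8 * q ^ 1 + 5 * μ ^ 2 / 128 * q ^ 2 + 15 * μ ^ 3 / 1024 * q ^ 3

/-- The derivative of `ampPoly` in `q`. -/
noncomputable def ampPolyDeriv (μ q : ℂ) : ℂ :=
  μ / 8 + 5 * μ ^ 2 / 64 * q ^ 1 + 45 * μ ^ 3 / 1024 * q ^ 2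

/-- The second derivative of `ampPoly` in `q`. -/
noncomputable def ampPolyDeriv₂ (μ q : ℂ) : ℂ :=
  5 * μ ^ 2 / 64 + 45 * μ ^ 3 / 512 * q

/-- `P₁` as a polynomial in `μ = 1 / λ` and `q = 1 / x`. -/
noncomputable def phasePoly (μ q : ℂ) : ℂ :=
  1 + -(5 * μ / 12) * q ^ 1 + -(5 * μ ^ 2 / 32) * q ^ 2 + 5 * μ ^ 3 / 128 * q ^ 3
    + 25 * μ ^ 4 / 6144 * q ^ 4 + (7 * μ ^ 5 - 1152 * μ) / 8192 * q ^ 5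

/-- The derivative of `phasePoly` in `q`. -/
noncomputable def phasePolyDeriv (μ q : ℂ) : ℂ :=
  -(5 * μ / 12) + -(5 * μ ^ 2 / 16) * q ^ 1 + 15 * μ ^ 3 / 128 * q ^ 2
    + 25 * μ ^ 4 / 1536 * q ^ 3 + 5 * (7 * μ ^ 5 - 1152 * μ) / 8192 * q ^ 4

/-- The polynomial `D` for which `(P₁ x^(5/2))' = (5/2) x^(3/2) D`. -/
noncomputable def freqPoly (μ q : ℂ) : ℂ :=
  1 + -(μ / 4) * q ^ 1 + -(μ ^ 2 / 32) * q ^ 2 + -(μ ^ 3 / 128) * q ^ 3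
    + -(5 * μ ^ 4 / 2048) * q ^ 4 + -((7 * μ ^ 5 - 1152 * μ) / 8192) * q ^ 5

/-- The derivative of `freqPoly` in `q`. -/
noncomputable def freqPolyDeriv (μ q : ℂ) : ℂ :=
  -(μ / 4) + -(μ ^ 2 / 16) * q ^ 1 + -(3 * μ ^ 3 / 128) * q ^ 2
    + -(5 * μ ^ 4 / 512) * q ^ 3 + -(5 * (7 * μ ^ 5 - 1152 * μ) / 8192) * q ^ 4

/-- The quotient of `1 - μ q / 2 + 9 μ q ^ 5 / 32 - D ^ 2` by `q ^ 6`. -/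
noncomputable def freqSqQuot (μ q : ℂ) : ℂ :=
  (9 / 128) * μ ^ 2 + (-21 / 32768) * μ ^ 6 + (9 / 1024) * μ ^ 3 * q +
  (-3 / 32768) * μ ^ 7 * q + (9 / 4096) * μ ^ 4 * q ^ 2 + (-81 / 4194304) * μ ^ 8 * q ^ 2 +
  (45 / 65536) * μ ^ 5 * q ^ 3 + (-35 / 8388608) * μ ^ 9 * q ^ 3 + (-81 / 4096) * μ ^ 2 * q ^ 4 +
  (63 / 262144) * μ ^ 6 * q ^ 4 + (-49 / 67108864) * μ ^ 10 * q ^ 4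

/-- The quotient of `D' P₀ + 2 D P₀'` by `q ^ 3`. -/
noncomputable def transportQuot (μ q : ℂ) : ℂ :=
  (-195 / 4096) * μ ^ 4 + (45 / 64) * μ * q + (-195 / 16384) * μ ^ 5 * q +
  (63 / 512) * μ ^ 2 * q ^ 2 + (-333 / 131072) * μ ^ 6 * q ^ 2 + (405 / 8192) * μ ^ 3 * q ^ 3 +
  (-345 / 524288) * μ ^ 7 * q ^ 3 + (1485 / 65536) * μ ^ 4 * q ^ 4 +
  (-1155 / 8388608) * μ ^ 8 * q ^ 4

/-- The quotient of `D P₀ ^ 2 - 1` by `q ^ 4`. -/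
noncomputable def wronskianQuot (μ q : ℂ) : ℂ :=
  (-195 / 16384) * μ ^ 4 + (9 / 64) * μ * q + (-117 / 32768) * μ ^ 5 * q +
  (9 / 256) * μ ^ 2 * q ^ 2 + (-1029 / 1048576) * μ ^ 6 * q ^ 2 + (27 / 2048) * μ ^ 3 * q ^ 3 +
  (-1281 / 4194304) * μ ^ 7 * q ^ 3 + (45 / 8192) * μ ^ 4 * q ^ 4 +
  (-1035 / 16777216) * μ ^ 8 * q ^ 4 + (765 / 1048576) * μ ^ 5 * q ^ 5 +
  (-1195 / 134217728) * μ ^ 9 * q ^ 5 + (675 / 4194304) * μ ^ 6 * q ^ 6 +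
  (-3225 / 2147483648) * μ ^ 10 * q ^ 6 + (2025 / 67108864) * μ ^ 7 * q ^ 7 +
  (-1575 / 8589934592) * μ ^ 11 * q ^ 7

/-- This is the eikonal equation. Multiplied by 2λx³, the first two terms on the right become x² and
-9/(16x²), which cancel the terms left by the amplitude x^(-1/4) exp(x²/2). The second one is the
source of the 1152 in P₁. -/
theorem freqPoly_sq (μ q : ℂ) :
    1 - freqPoly μ q ^ 2 = μ * q / 2 - 9 / 32 * μ * q ^ 5 + q ^ 6 * freqSqQuot μ q := by
  unfold freqPoly freqSqQuot
  ring

/-- In the exact WKB ansatz D P₀² is constant, so this expression would vanish. The truncation of P₀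
leaves a multiple of q³. -/
theorem transport_eq (μ q : ℂ) :
    freqPolyDeriv μ q * ampPoly μ q + 2 * freqPoly μ q * ampPolyDeriv μ q =
      q ^ 3 * transportQuot μ q := by
  unfold freqPoly freqPolyDeriv ampPoly ampPolyDeriv transportQuot
  ring

theorem freqPoly_mul_ampPoly_sq (μ q : ℂ) :
    freqPoly μ q * ampPoly μ q ^ 2 - 1 = q ^ 4 * wronskianQuot μ q := by
  unfold freqPoly ampPoly wronskianQuot
  ring

theorem freqPoly_eq (μ q : ℂ) :
    freqPoly μ q = phasePoly μ q - 2 / 5 * q * phasePolyDeriv μ q := by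
  unfold freqPoly phasePoly phasePolyDeriv
  ring

theorem hasDerivAt_const_mul_pow (c : ℂ) (n : ℕ) (q : ℂ) :
    HasDerivAt (fun q : ℂ => c * q ^ n) (c * (n * q ^ (n - 1))) q :=
  (hasDerivAt_pow n q).const_mul c

theorem hasDerivAt_ampPoly (μ q : ℂ) : HasDerivAt (ampPoly μ) (ampPolyDeriv μ q) q := by
  refine (((hasDerivAt_const q (1 : ℂ)).add (hasDerivAt_const_mul_pow _ 1 q)).add
    (hasDerivAt_const_mul_pow _ 2 q) |>.add (hasDerivAt_const_mul_pow _ 3 q)).congr_deriv ?_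
  unfold ampPolyDeriv
  norm_num
  ring

theorem hasDerivAt_ampPolyDeriv (μ q : ℂ) :
    HasDerivAt (ampPolyDeriv μ) (ampPolyDeriv₂ μ q) q := by
  refine (((hasDerivAt_const q (μ / 8)).add (hasDerivAt_const_mul_pow _ 1 q)).add
    (hasDerivAt_const_mul_pow _ 2 q)).congr_deriv ?_
  unfold ampPolyDeriv₂
  norm_num
  ring

theorem hasDerivAt_phasePoly (μ q : ℂ) : HasDerivAt (phasePoly μ) (phasePolyDeriv μ q) q := by
  refine (((((hasDerivAt_const q (1 : ℂ)).add (hasDerivAt_const_mul_pow _ 1 q)).add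
    (hasDerivAt_const_mul_pow _ 2 q)).add (hasDerivAt_const_mul_pow _ 3 q)).add
    (hasDerivAt_const_mul_pow _ 4 q) |>.add (hasDerivAt_const_mul_pow _ 5 q)).congr_deriv ?_
  unfold phasePolyDeriv
  norm_num
  ring

theorem hasDerivAt_freqPoly (μ q : ℂ) : HasDerivAt (freqPoly μ) (freqPolyDeriv μ q) q := by
  refine (((((hasDerivAt_const q (1 : ℂ)).add (hasDerivAt_const_mul_pow _ 1 q)).add
    (hasDerivAt_const_mul_pow _ 2 q)).add (hasDerivAt_const_mul_pow _ 3 q)).add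
    (hasDerivAt_const_mul_pow _ 4 q) |>.add (hasDerivAt_const_mul_pow _ 5 q)).congr_deriv ?_
  unfold freqPolyDeriv
  norm_num
  ring

theorem P0_eq_ampPoly (lam x : ℂ) : P0 lam x = ampPoly lam⁻¹ x⁻¹ := by
  unfold P0 ampPoly
  simp only [div_eq_mul_inv, mul_inv, inv_pow]
  ring

theorem P1_eq_phasePoly {lam : ℂ} (hlam : lam ≠ 0) (x : ℂ) :
    P1 lam x = phasePoly lam⁻¹ x⁻¹ := by
  have h : lam ^ 4 * lam⁻¹ ^ 5 = lam⁻¹ := by field_simp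
  unfold P1 phasePoly
  simp only [div_eq_mul_inv, mul_inv, inv_pow] at h ⊢
  linear_combination (-1152 / 8192 * (x ^ 5)⁻¹) * h

theorem tendsto_inv_ofReal : Tendsto (fun x : ℝ => (x : ℂ)⁻¹) atTop (𝓝 0) := by
  have := (Complex.continuous_ofReal.tendsto 0).comp tendsto_inv_atTop_zero
  simpa [Function.comp_def] using this

theorem tendsto_comp_inv {F : ℂ → ℂ} (hF : ContinuousAt F 0) :
    Tendsto (fun x : ℝ => F ((x : ℂ)⁻¹)) atTop (𝓝 (F 0)) :=
  hF.tendsto.comp tendsto_inv_ofReal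

theorem comp_inv_isBigO_one {F : ℂ → ℂ} (hF : ContinuousAt F 0) :
    (fun x : ℝ => F ((x : ℂ)⁻¹)) =O[atTop] fun _ : ℝ => (1 : ℝ) :=
  (tendsto_comp_inv hF).isBigO_one ℝ

theorem inv_pow_isBigO (n : ℕ) {s : ℝ} (hs : -(n : ℝ) ≤ s) :
    (fun x : ℝ => (x : ℂ)⁻¹ ^ n) =O[atTop] fun x : ℝ => x ^ s := by
  refine IsBigO.of_bound 1 ?_
  filter_upwards [eventually_ge_atTop 1] with x hx
  have hx0 : 0 < x := by linarith
  rw [Real.norm_of_nonneg (Real.rpow_nonneg hx0.le _), one_mul, norm_pow, norm_inv,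
    Complex.norm_real, Real.norm_of_nonneg hx0.le]
  calc x⁻¹ ^ n = x ^ (-(n : ℝ)) := by rw [Real.rpow_neg hx0.le, Real.rpow_natCast, inv_pow]
    _ ≤ x ^ s := Real.rpow_le_rpow_of_exponent_le hx hs

theorem hasDerivAt_comp_inv {F F' : ℂ → ℂ} (hF : ∀ q, HasDerivAt F (F' q) q) {x : ℝ}
    (hx : 0 < x) :
    HasDerivAt (fun x : ℝ => F ((x : ℂ)⁻¹)) (-(x : ℂ)⁻¹ ^ 2 * F' (x : ℂ)⁻¹) x := by
  have hx' : (x : ℂ) ≠ 0 := by exact_mod_cast hx.ne'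
  have h1 : HasDerivAt (fun x : ℝ => (x : ℂ)⁻¹) (-(x : ℂ)⁻¹ ^ 2) x := by
    have := (hasDerivAt_id (x : ℂ)).comp_ofReal.inv hx'
    refine this.congr_deriv ?_
    simp [neg_div]
  exact ((hF _).comp x h1).congr_deriv (mul_comm _ _)

/-! ### The approximate solutions -/

/-- `√(8λ/25)`. -/
noncomputable def root (lam : ℂ) : ℂ := Complex.sqrt (8 * lam / 25)

theorem root_sq (lam : ℂ) : root lam ^ 2 = 8 * lam / 25 := by
  have := Complex.cpow_nat_inv_pow (8 * lam / 25) (n := 2) two_ne_zero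
  exact_mod_cast this

theorem root_ne_zero {lam : ℂ} (hlam : lam ≠ 0) : root lam ≠ 0 := by
  intro h
  have := root_sq lam
  rw [h] at this
  apply hlam
  linear_combination (-25 / 8) * this

/-- The phase `√(8λ/25) P₁(x) x^(5/2)`. -/
noncomputable def phase (lam : ℂ) (x : ℝ) : ℂ :=
  root lam * P1 lam (x : ℂ) * ((x ^ (5 / 2 : ℝ) : ℝ) : ℂ)

/-- The derivative of `phase`. -/
noncomputable def freq (lam : ℂ) (x : ℝ) : ℂ :=
  root lam * (5 / 2) * ((x ^ (3 / 2 : ℝ) : ℝ) : ℂ) * freqPoly lam⁻¹ (x : ℂ)⁻¹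

/-- The logarithmic derivative of the amplitude `x^(-1/4) exp(x²/2) P₀(x)`. -/
noncomputable def ampLogDeriv (lam : ℂ) (x : ℝ) : ℂ :=
  x - (x : ℂ)⁻¹ / 4 -
    (x : ℂ)⁻¹ ^ 2 * (ampPolyDeriv lam⁻¹ (x : ℂ)⁻¹ / ampPoly lam⁻¹ (x : ℂ)⁻¹)

/-- The logarithmic derivative of `mode lam σ`. -/
noncomputable def modeLogDeriv (lam σ : ℂ) (x : ℝ) : ℂ :=
  ampLogDeriv lam x + σ * Complex.I * freq lam x

theorem mode_eq (lam σ : ℂ) (x : ℝ) : mode lam σ x =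
    ((x ^ (-(1 / 4) : ℝ) * Real.exp (x ^ 2 / 2) : ℝ) : ℂ) * P0 lam (x : ℂ) *
      Complex.exp (σ * Complex.I * phase lam x) := by
  rw [mode, phase, root]
  congr 2
  ring

theorem rpow_five_half {x : ℝ} (hx : 0 < x) : x ^ (5 / 2 : ℝ) = x * x ^ (3 / 2 : ℝ) := by
  rw [show (5 / 2 : ℝ) = 1 + 3 / 2 by norm_num, Real.rpow_add hx, Real.rpow_one]

theorem rpow_half {x : ℝ} (hx : 0 < x) : x ^ (1 / 2 : ℝ) = x⁻¹ * x ^ (3 / 2 : ℝ) := by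
  rw [show (1 / 2 : ℝ) = -1 + 3 / 2 by norm_num, Real.rpow_add hx, Real.rpow_neg_one]

theorem rpow_three_half_sq {x : ℝ} (hx : 0 < x) : (x ^ (3 / 2 : ℝ)) ^ 2 = x ^ 3 := by
  rw [← Real.rpow_natCast, ← Real.rpow_mul hx.le, ← Real.rpow_natCast]
  norm_num

theorem hasDerivAt_phase {lam : ℂ} (hlam : lam ≠ 0) {x : ℝ} (hx : 0 < x) :
    HasDerivAt (phase lam) (freq lam x) x := by
  have hx' : (x : ℂ) ≠ 0 := by exact_mod_cast hx.ne'
  have h1 := ((hasDerivAt_comp_inv (hasDerivAt_phasePoly lam⁻¹) hx).const_mul (root lam)).mul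
    (Real.hasDerivAt_rpow_const (p := 5 / 2) (Or.inl hx.ne')).ofReal_comp
  have h2 : phase lam =
      fun x : ℝ => root lam * phasePoly lam⁻¹ (x : ℂ)⁻¹ * ((x ^ (5 / 2 : ℝ) : ℝ) : ℂ) := by
    funext x
    rw [phase, P1_eq_phasePoly hlam]
  rw [h2]
  refine h1.congr_deriv ?_
  rw [freq, freqPoly_eq, show (5 / 2 - 1 : ℝ) = 3 / 2 by norm_num, rpow_five_half hx]
  push_cast
  field_simp
  ring

theorem hasDerivAt_freq (lam : ℂ) {x : ℝ} (hx : 0 < x) :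
    HasDerivAt (freq lam) (root lam * (5 / 2) * ((x ^ (3 / 2 : ℝ) : ℝ) : ℂ) *
      (3 / 2 * (x : ℂ)⁻¹ * freqPoly lam⁻¹ (x : ℂ)⁻¹ -
        (x : ℂ)⁻¹ ^ 2 * freqPolyDeriv lam⁻¹ (x : ℂ)⁻¹)) x := by
  have h1 := ((Real.hasDerivAt_rpow_const (p := 3 / 2)
    (Or.inl hx.ne')).ofReal_comp.const_mul (root lam * (5 / 2))).mul
    (hasDerivAt_comp_inv (hasDerivAt_freqPoly lam⁻¹) hx)
  refine h1.congr_deriv ?_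
  rw [show (3 / 2 - 1 : ℝ) = 1 / 2 by norm_num, rpow_half hx]
  push_cast
  ring

theorem hasDerivAt_mode {lam : ℂ} (hlam : lam ≠ 0) (σ : ℂ) {x : ℝ} (hx : 0 < x)
    (hP : ampPoly lam⁻¹ (x : ℂ)⁻¹ ≠ 0) :
    HasDerivAt (mode lam σ) (modeLogDeriv lam σ x * mode lam σ x) x := by
  have hx' : (x : ℂ) ≠ 0 := by exact_mod_cast hx.ne'
  have h0 : HasDerivAt (fun x : ℝ => x ^ (-(1 / 4) : ℝ) * Real.exp (x ^ 2 / 2))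
      (x ^ (-(1 / 4) : ℝ) * Real.exp (x ^ 2 / 2) * (x - x⁻¹ / 4)) x := by
    have h1 := ((hasDerivAt_pow 2 x).div_const 2).exp
    refine ((Real.hasDerivAt_rpow_const (p := -(1 / 4)) (Or.inl hx.ne')).mul h1).congr_deriv ?_
    rw [Real.rpow_sub_one hx.ne']
    push_cast
    field_simp
    ring
  have h2 := (h0.ofReal_comp.mul (hasDerivAt_comp_inv (hasDerivAt_ampPoly lam⁻¹) hx)).mul
    ((hasDerivAt_phase hlam hx).const_mul (σ * Complex.I)).cexp
  have h3 : mode lam σ = fun x => ((x ^ (-(1 / 4) : ℝ) * Real.exp (x ^ 2 / 2) : ℝ) : ℂ) *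
      ampPoly lam⁻¹ (x : ℂ)⁻¹ * Complex.exp (σ * Complex.I * phase lam x) := by
    funext x
    rw [mode_eq, P0_eq_ampPoly]
  rw [h3]
  refine h2.congr_deriv ?_
  rw [modeLogDeriv, ampLogDeriv]
  simp only [Pi.mul_apply]
  generalize ampPoly lam⁻¹ (x : ℂ)⁻¹ = A at hP ⊢
  generalize ampPolyDeriv lam⁻¹ (x : ℂ)⁻¹ = A'
  push_cast
  field_simp
  ring

/-- The derivative of `ampLogDeriv`. -/
noncomputable def ampLogDeriv₂ (lam : ℂ) (x : ℝ) : ℂ :=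
  1 + (x : ℂ)⁻¹ ^ 2 / 4 +
    ((x : ℂ)⁻¹ ^ 4 * ampPolyDeriv₂ lam⁻¹ (x : ℂ)⁻¹ +
      2 * (x : ℂ)⁻¹ ^ 3 * ampPolyDeriv lam⁻¹ (x : ℂ)⁻¹) / ampPoly lam⁻¹ (x : ℂ)⁻¹ -
    ((x : ℂ)⁻¹ ^ 2 * (ampPolyDeriv lam⁻¹ (x : ℂ)⁻¹ / ampPoly lam⁻¹ (x : ℂ)⁻¹)) ^ 2

theorem hasDerivAt_ampLogDeriv (lam : ℂ) {x : ℝ} (hx : 0 < x)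
    (hP : ampPoly lam⁻¹ (x : ℂ)⁻¹ ≠ 0) :
    HasDerivAt (ampLogDeriv lam) (ampLogDeriv₂ lam x) x := by
  have hx' : (x : ℂ) ≠ 0 := by exact_mod_cast hx.ne'
  have hq := hasDerivAt_comp_inv (F := fun q => q) (F' := fun _ => 1)
    (fun q => hasDerivAt_id q) hx
  have h1 := ((hasDerivAt_id (x : ℂ)).comp_ofReal.sub (hq.div_const 4)).sub
    ((hq.pow 2).mul ((hasDerivAt_comp_inv (hasDerivAt_ampPolyDeriv lam⁻¹) hx).div
      (hasDerivAt_comp_inv (hasDerivAt_ampPoly lam⁻¹) hx) hP))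
  refine h1.congr_deriv ?_
  rw [ampLogDeriv₂]
  simp only [Pi.pow_apply, Pi.div_apply]
  generalize ampPoly lam⁻¹ (x : ℂ)⁻¹ = A at hP ⊢
  generalize ampPolyDeriv lam⁻¹ (x : ℂ)⁻¹ = A'
  generalize ampPolyDeriv₂ lam⁻¹ (x : ℂ)⁻¹ = A''
  push_cast
  field_simp
  ring

/-- The derivative of `freq`. -/
noncomputable def freqDeriv (lam : ℂ) (x : ℝ) : ℂ :=
  root lam * (5 / 2) * ((x ^ (3 / 2 : ℝ) : ℝ) : ℂ) *
    (3 / 2 * (x : ℂ)⁻¹ * freqPoly lam⁻¹ (x : ℂ)⁻¹ -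
      (x : ℂ)⁻¹ ^ 2 * freqPolyDeriv lam⁻¹ (x : ℂ)⁻¹)

/-- The relative residual of `mode lam σ` in the equation, see `hasDerivAt_modeFlux`. -/
noncomputable def residual (lam σ : ℂ) (x : ℝ) : ℂ :=
  ampLogDeriv₂ lam x + σ * Complex.I * freqDeriv lam x + modeLogDeriv lam σ x ^ 2 +
    (-2 * (x : ℂ) - (x : ℂ)⁻¹ + (psiNumDeriv x : ℂ) / psiNum x) * modeLogDeriv lam σ x +
    lam * (2 * (x : ℂ) ^ 3 / psiNum x)

/-- The flux `Ψ w z'` of the approximate solution `z = mode lam σ`. -/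
noncomputable def modeFlux (lam σ : ℂ) (x : ℝ) : ℂ :=
  (fluxCoeff x : ℂ) * (modeLogDeriv lam σ x * mode lam σ x)

theorem hasDerivAt_modeFlux {lam : ℂ} (hlam : lam ≠ 0) (σ : ℂ) {x : ℝ} (hx : 0 < x)
    (hP : ampPoly lam⁻¹ (x : ℂ)⁻¹ ≠ 0) :
    HasDerivAt (modeFlux lam σ) (-(lam * (weight x : ℂ) * mode lam σ x) +
      (fluxCoeff x : ℂ) * residual lam σ x * mode lam σ x) x := by
  have hx' : (x : ℂ) ≠ 0 := by exact_mod_cast hx.ne'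
  have hg : (psiNum x : ℂ) ≠ 0 := by exact_mod_cast (psiNum_pos hx).ne'
  have h1 := (hasDerivAt_fluxCoeff hx).ofReal_comp.mul
    (((hasDerivAt_ampLogDeriv lam hx hP).add
      ((hasDerivAt_freq lam hx).const_mul (σ * Complex.I))).mul (hasDerivAt_mode hlam σ hx hP))
  refine h1.congr_deriv ?_
  have hw : (weight x : ℂ) = fluxCoeff x * (2 * (x : ℂ) ^ 3 / psiNum x) := by
    rw [fluxCoeff, Psi_eq]
    push_cast
    field_simp
  have hy : (ampLogDeriv lam + fun x => σ * Complex.I * freq lam x) x = modeLogDeriv lam σ x :=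
    rfl
  simp only [Pi.mul_apply, hy]
  rw [hw, residual, freqDeriv]
  push_cast
  ring

/-- The residual is sorted into the part even in σ (eikonal equation), the part odd in σ (transport
equation), and two terms due to erf not being exactly 1. All growing terms cancel, leaving explicit
powers of 1/x. -/
theorem residual_eq {lam σ : ℂ} (hlam : lam ≠ 0) (hσ : σ ^ 2 = 1) {x : ℝ} (hx : 0 < x)
    (hP : ampPoly lam⁻¹ (x : ℂ)⁻¹ ≠ 0) :
    residual lam σ x =
      (x : ℂ)⁻¹ ^ 3 * (2 * lam * freqSqQuot lam⁻¹ (x : ℂ)⁻¹ +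
        ((x : ℂ)⁻¹ * ampPolyDeriv₂ lam⁻¹ (x : ℂ)⁻¹ + 7 / 2 * ampPolyDeriv lam⁻¹ (x : ℂ)⁻¹) /
          ampPoly lam⁻¹ (x : ℂ)⁻¹) -
      σ * Complex.I * (root lam * (5 / 2)) * (((x ^ (3 / 2 : ℝ) : ℝ) : ℂ) * (x : ℂ)⁻¹ ^ 5 *
        (transportQuot lam⁻¹ (x : ℂ)⁻¹ / ampPoly lam⁻¹ (x : ℂ)⁻¹)) +
      (psiNumDeriv x : ℂ) / psiNum x * modeLogDeriv lam σ x +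
      2 * lam * ((x : ℂ) ^ 3 * ((1 - psiNum x) / psiNum x)) := by
  have hx' : (x : ℂ) ≠ 0 := by exact_mod_cast hx.ne'
  have hg : (psiNum x : ℂ) ≠ 0 := by exact_mod_cast (psiNum_pos hx).ne'
  have hS : ((x ^ (3 / 2 : ℝ) : ℝ) : ℂ) ^ 2 = (x : ℂ) ^ 3 := by
    exact_mod_cast rpow_three_half_sq hx
  have hr := root_sq lam
  have hF := freqPoly_sq lam⁻¹ (x : ℂ)⁻¹
  have hT := transport_eq lam⁻¹ (x : ℂ)⁻¹
  have hI := Complex.I_sq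
  have hxq : (x : ℂ) * (x : ℂ)⁻¹ = 1 := mul_inv_cancel₀ hx'
  have hlm : lam * lam⁻¹ = 1 := mul_inv_cancel₀ hlam
  -- The constant 8/25 is chosen for this: (5/2)² · 8λ/25 = 2λ matches the factor 2λx³ in the
  -- equation.
  have hsq : (σ * Complex.I * freq lam x) ^ 2 =
      -(2 * lam * (x : ℂ) ^ 3 * freqPoly lam⁻¹ (x : ℂ)⁻¹ ^ 2) := by
    rw [freq]
    calc _ = σ ^ 2 * Complex.I ^ 2 * root lam ^ 2 * (25 / 4) *
          ((x ^ (3 / 2 : ℝ) : ℝ) : ℂ) ^ 2 * freqPoly lam⁻¹ (x : ℂ)⁻¹ ^ 2 := by ring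
      _ = _ := by rw [hσ, hI, hr, hS]; ring
  have hint : 2 * lam * (x : ℂ) ^ 3 * (1 - freqPoly lam⁻¹ (x : ℂ)⁻¹ ^ 2) =
      (x : ℂ) ^ 2 - 9 / 16 * (x : ℂ)⁻¹ ^ 2 +
        2 * lam * ((x : ℂ)⁻¹ ^ 3 * freqSqQuot lam⁻¹ (x : ℂ)⁻¹) := by
    rw [hF]
    generalize freqSqQuot lam⁻¹ (x : ℂ)⁻¹ = Q
    field_simp
    ring
  have hdiv : (2 * (x : ℂ) ^ 3 / psiNum x) =
      2 * ((x : ℂ) ^ 3 * ((1 - psiNum x) / psiNum x)) + 2 * (x : ℂ) ^ 3 := by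
    field_simp
    ring
  have hodd : freqDeriv lam x + 2 * ampLogDeriv lam x * freq lam x +
      (-2 * (x : ℂ) - (x : ℂ)⁻¹) * freq lam x =
      -((root lam * (5 / 2)) * (((x ^ (3 / 2 : ℝ) : ℝ) : ℂ) * (x : ℂ)⁻¹ ^ 5 *
        (transportQuot lam⁻¹ (x : ℂ)⁻¹ / ampPoly lam⁻¹ (x : ℂ)⁻¹))) := by
    have hT' : transportQuot lam⁻¹ (x : ℂ)⁻¹ = (x : ℂ) ^ 3 *
        (freqPolyDeriv lam⁻¹ (x : ℂ)⁻¹ * ampPoly lam⁻¹ (x : ℂ)⁻¹ +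
          2 * freqPoly lam⁻¹ (x : ℂ)⁻¹ * ampPolyDeriv lam⁻¹ (x : ℂ)⁻¹) := by
      rw [hT]
      field_simp
    rw [hT', freqDeriv, freq, ampLogDeriv]
    generalize ampPoly lam⁻¹ (x : ℂ)⁻¹ = A at hP ⊢
    generalize ampPolyDeriv lam⁻¹ (x : ℂ)⁻¹ = A'
    generalize freqPoly lam⁻¹ (x : ℂ)⁻¹ = D
    generalize freqPolyDeriv lam⁻¹ (x : ℂ)⁻¹ = D'
    field_simp
    ring
  have heven : ampLogDeriv₂ lam x + ampLogDeriv lam x ^ 2 +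
      (-2 * (x : ℂ) - (x : ℂ)⁻¹) * ampLogDeriv lam x =
      -(x : ℂ) ^ 2 + 9 / 16 * (x : ℂ)⁻¹ ^ 2 + (x : ℂ)⁻¹ ^ 3 *
        (((x : ℂ)⁻¹ * ampPolyDeriv₂ lam⁻¹ (x : ℂ)⁻¹ + 7 / 2 * ampPolyDeriv lam⁻¹ (x : ℂ)⁻¹) /
          ampPoly lam⁻¹ (x : ℂ)⁻¹) := by
    rw [ampLogDeriv₂, ampLogDeriv]
    generalize ampPoly lam⁻¹ (x : ℂ)⁻¹ = A at hP ⊢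
    generalize ampPolyDeriv lam⁻¹ (x : ℂ)⁻¹ = A'
    generalize ampPolyDeriv₂ lam⁻¹ (x : ℂ)⁻¹ = A''
    field_simp
    ring
  rw [residual, hdiv]
  have hy : modeLogDeriv lam σ x = ampLogDeriv lam x + σ * Complex.I * freq lam x := rfl
  have hy2 : modeLogDeriv lam σ x ^ 2 = ampLogDeriv lam x ^ 2 +
      2 * ampLogDeriv lam x * (σ * Complex.I * freq lam x) +
      -(2 * lam * (x : ℂ) ^ 3 * freqPoly lam⁻¹ (x : ℂ)⁻¹ ^ 2) := by
    rw [hy, ← hsq]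
    ring
  rw [hy2]
  linear_combination heven + hint + σ * Complex.I * hodd +
    (-2 * (x : ℂ) - (x : ℂ)⁻¹) * hy

theorem ampPoly_zero (μ : ℂ) : ampPoly μ 0 = 1 := by simp [ampPoly]

theorem freqPoly_zero (μ : ℂ) : freqPoly μ 0 = 1 := by simp [freqPoly]

theorem tendsto_ampPoly (μ : ℂ) :
    Tendsto (fun x : ℝ => ampPoly μ (x : ℂ)⁻¹) atTop (𝓝 1) := by
  rw [← ampPoly_zero μ]
  exact tendsto_comp_inv (hasDerivAt_ampPoly μ 0).continuousAt

theorem tendsto_freqPoly (μ : ℂ) :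
    Tendsto (fun x : ℝ => freqPoly μ (x : ℂ)⁻¹) atTop (𝓝 1) := by
  rw [← freqPoly_zero μ]
  exact tendsto_comp_inv (hasDerivAt_freqPoly μ 0).continuousAt

theorem eventually_ampPoly_ne_zero (μ : ℂ) :
    ∀ᶠ x : ℝ in atTop, ampPoly μ (x : ℂ)⁻¹ ≠ 0 :=
  (tendsto_ampPoly μ).eventually_ne one_ne_zero

theorem rpow_isBigO_rpow {s t : ℝ} (h : s ≤ t) :
    (fun x : ℝ => x ^ s) =O[atTop] fun x : ℝ => x ^ t := by
  refine IsBigO.of_bound 1 ?_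
  filter_upwards [eventually_ge_atTop 1] with x hx
  rw [Real.norm_of_nonneg (by positivity), Real.norm_of_nonneg (by positivity), one_mul]
  exact Real.rpow_le_rpow_of_exponent_le hx h

theorem IsBigO.mul_rpow {f g : ℝ → ℂ} {s t : ℝ} (hf : f =O[atTop] fun x : ℝ => x ^ s)
    (hg : g =O[atTop] fun x : ℝ => x ^ t) {r : ℝ} (hr : s + t ≤ r) :
    (fun x => f x * g x) =O[atTop] fun x : ℝ => x ^ r := by
  refine ((hf.mul hg).trans_eventuallyEq (g₂ := fun x : ℝ => x ^ (s + t)) ?_).trans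
    (rpow_isBigO_rpow hr)
  filter_upwards [eventually_gt_atTop 0] with x hx
  rw [Real.rpow_add hx]

theorem isBigO_rpow_of_isBigO_one {f : ℝ → ℂ} (hf : f =O[atTop] fun _ : ℝ => (1 : ℝ)) :
    f =O[atTop] fun x : ℝ => x ^ (0 : ℝ) := by
  simpa using hf

theorem ofReal_rpow_isBigO (s : ℝ) :
    (fun x : ℝ => ((x ^ s : ℝ) : ℂ)) =O[atTop] fun x : ℝ => x ^ s :=
  IsBigO.of_bound 1 (Eventually.of_forall fun x => by simp)

theorem ofReal_pow_isBigO (n : ℕ) :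
    (fun x : ℝ => (x : ℂ) ^ n) =O[atTop] fun x : ℝ => x ^ (n : ℝ) :=
  IsBigO.of_bound 1 (Eventually.of_forall fun x => by simp)

theorem freq_isBigO (lam : ℂ) : freq lam =O[atTop] fun x : ℝ => x ^ (3 / 2 : ℝ) := by
  have h1 := ((ofReal_rpow_isBigO (3 / 2)).const_mul_left (root lam * (5 / 2)))
  exact IsBigO.mul_rpow h1 (isBigO_rpow_of_isBigO_one ((tendsto_freqPoly lam⁻¹).isBigO_one ℝ))
    (by norm_num)

theorem ampLogDeriv_isBigO (lam : ℂ) : ampLogDeriv lam =O[atTop] fun x : ℝ => x ^ (1 : ℝ) := by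
  have hF : ContinuousAt (fun q => ampPolyDeriv lam⁻¹ q / ampPoly lam⁻¹ q) 0 :=
    (hasDerivAt_ampPolyDeriv _ 0).continuousAt.div (hasDerivAt_ampPoly _ 0).continuousAt
      (by simp [ampPoly_zero])
  have h1 := ofReal_pow_isBigO 1
  have h2 := (inv_pow_isBigO 1 (s := 1) (by norm_num)).const_mul_left (1 / 4)
  have h3 := IsBigO.mul_rpow (r := 1) (inv_pow_isBigO 2 (s := 1) (by norm_num))
    (isBigO_rpow_of_isBigO_one (comp_inv_isBigO_one hF)) (by norm_num)
  simp only [Nat.cast_one] at h1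
  refine ((h1.sub h2).sub h3).congr_left fun x => ?_
  rw [ampLogDeriv]
  ring

theorem ofReal_psiNum_inv_isBigO :
    (fun x : ℝ => (psiNum x : ℂ)⁻¹) =O[atTop] fun x : ℝ => x ^ (0 : ℝ) := by
  have h := (Complex.continuous_ofReal.tendsto 1).comp tendsto_psiNum
  have h2 := h.inv₀ (by simp)
  exact isBigO_rpow_of_isBigO_one (h2.isBigO_one ℝ)

theorem residual_isBigO {lam σ : ℂ} (hlam : lam ≠ 0) (hσ : σ ^ 2 = 1) :
    residual lam σ =O[atTop] fun x : ℝ => x ^ (-3 : ℝ) := by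
  have hA := (hasDerivAt_ampPoly lam⁻¹ 0).continuousAt
  have hA0 : ampPoly lam⁻¹ 0 ≠ 0 := by simp [ampPoly_zero]
  have hF1 : ContinuousAt (fun q => 2 * lam * freqSqQuot lam⁻¹ q +
      (q * ampPolyDeriv₂ lam⁻¹ q + 7 / 2 * ampPolyDeriv lam⁻¹ q) / ampPoly lam⁻¹ q) 0 := by
    refine ContinuousAt.add ?_ (ContinuousAt.div ?_ hA hA0)
    · unfold freqSqQuot
      fun_prop
    · unfold ampPolyDeriv₂ ampPolyDeriv
      fun_prop
  have hF2 : ContinuousAt (fun q => transportQuot lam⁻¹ q / ampPoly lam⁻¹ q) 0 := by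
    refine ContinuousAt.div ?_ hA hA0
    unfold transportQuot
    fun_prop
  have h1 := IsBigO.mul_rpow (r := -3) (inv_pow_isBigO 3 (s := -3) (by norm_num))
    (isBigO_rpow_of_isBigO_one (comp_inv_isBigO_one hF1)) (by norm_num)
  have h2 := (IsBigO.mul_rpow (r := -3) (IsBigO.mul_rpow (r := -7 / 2) (ofReal_rpow_isBigO (3 / 2))
    (inv_pow_isBigO 5 (s := -5) (by norm_num)) (by norm_num))
    (isBigO_rpow_of_isBigO_one (comp_inv_isBigO_one hF2)) (by norm_num)).const_mul_left
      (σ * Complex.I * (root lam * (5 / 2)))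
  have hofReal : ∀ {f : ℝ → ℝ} {s : ℝ}, f =O[atTop] (fun x : ℝ => x ^ s) →
      (fun x => (f x : ℂ)) =O[atTop] fun x : ℝ => x ^ s := fun h =>
    (IsBigO.of_bound 1 (Eventually.of_forall fun x => by simp)).trans h
  have hy : modeLogDeriv lam σ =O[atTop] fun x : ℝ => x ^ (2 : ℝ) :=
    ((ampLogDeriv_isBigO lam).trans (rpow_isBigO_rpow (by norm_num))).add
      (((freq_isBigO lam).trans (rpow_isBigO_rpow (by norm_num))).const_mul_left (σ * Complex.I))
  -- The terms containing erf decay faster than any power. The exponents -5 here and -6 below are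
  -- just enough to reach -3.
  have h3 := IsBigO.mul_rpow (r := -3) (IsBigO.mul_rpow (r := -5)
    (hofReal (psiNumDeriv_isBigO (-5))) ofReal_psiNum_inv_isBigO (by norm_num)) hy (by norm_num)
  have h4 := (IsBigO.mul_rpow (r := -3) (ofReal_pow_isBigO 3) (IsBigO.mul_rpow (r := -6)
    (hofReal (psiNum_sub_one_isBigO (s := 6) (by norm_num))).neg_left ofReal_psiNum_inv_isBigO
      (by norm_num)) (by norm_num)).const_mul_left (2 * lam)
  refine (((h1.sub h2).add h3).add h4).congr' ?_ EventuallyEq.rfl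
  filter_upwards [eventually_gt_atTop 0, eventually_ampPoly_ne_zero lam⁻¹] with x hx hP
  rw [residual_eq hlam hσ hx hP]
  push_cast
  ring

/-- The Wronskian of the two approximate solutions. -/
noncomputable def modeWronskian (lam : ℂ) (x : ℝ) : ℂ :=
  (fluxCoeff x : ℂ) * (mode lam 1 x * mode lam (-1) x) * (2 * Complex.I * freq lam x)

theorem mode_one_eq (lam : ℂ) (x : ℝ) :
    mode lam 1 x = Complex.exp (2 * Complex.I * phase lam x) * mode lam (-1) x := by
  rw [mode_eq, mode_eq]
  have : Complex.exp (1 * Complex.I * phase lam x) =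
      Complex.exp (2 * Complex.I * phase lam x) * Complex.exp (-1 * Complex.I * phase lam x) := by
    rw [← Complex.exp_add]
    ring_nf
  rw [this]
  ring

/-- The oscillating exponentials cancel each other, exp(x²/2)² cancels the weight, and x^(-1/2)
x^(3/2) cancels the 1/x in Ψ w. Only D P₀² and the numerator of Ψ remain, and both tend to 1. -/
theorem modeWronskian_eq (lam : ℂ) {x : ℝ} (hx : 0 < x) :
    modeWronskian lam x = (5 / 2 * Complex.I * root lam) *
      (psiNum x * (freqPoly lam⁻¹ (x : ℂ)⁻¹ * ampPoly lam⁻¹ (x : ℂ)⁻¹ ^ 2)) := by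
  have hE : Complex.exp (1 * Complex.I * phase lam x) * Complex.exp (-1 * Complex.I * phase lam x)
      = 1 := by
    rw [← Complex.exp_add]
    ring_nf
    simp
  have hreal : fluxCoeff x * (x ^ (-(1 / 4) : ℝ) * Real.exp (x ^ 2 / 2)) ^ 2 *
      x ^ (3 / 2 : ℝ) = psiNum x / 2 := by
    have h1 : (x ^ (-(1 / 4) : ℝ)) ^ 2 * x ^ (3 / 2 : ℝ) = x := by
      rw [← Real.rpow_natCast, ← Real.rpow_mul hx.le, ← Real.rpow_add hx]
      norm_num
    have h2 : Real.exp (-x ^ 2) * Real.exp (x ^ 2 / 2) ^ 2 = 1 := by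
      rw [← Real.exp_nat_mul, ← Real.exp_add]
      simp
      ring
    rw [fluxCoeff_eq hx]
    calc _ = psiNum x / (2 * x) * ((x ^ (-(1 / 4) : ℝ)) ^ 2 * x ^ (3 / 2 : ℝ)) *
          (Real.exp (-x ^ 2) * Real.exp (x ^ 2 / 2) ^ 2) := by ring
      _ = _ := by rw [h1, h2]; field_simp
  have hc : (fluxCoeff x : ℂ) * ((x ^ (-(1 / 4) : ℝ) * Real.exp (x ^ 2 / 2) : ℝ) : ℂ) ^ 2 *
      ((x ^ (3 / 2 : ℝ) : ℝ) : ℂ) = psiNum x / 2 := by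
    rw [← Complex.ofReal_pow, ← Complex.ofReal_mul, ← Complex.ofReal_mul, hreal]
    push_cast
    ring
  rw [modeWronskian, mode_eq, mode_eq, P0_eq_ampPoly, freq]
  generalize ((x ^ (-(1 / 4) : ℝ) * Real.exp (x ^ 2 / 2) : ℝ) : ℂ) = M at hc ⊢
  generalize Complex.exp (1 * Complex.I * phase lam x) = e at hE ⊢
  generalize Complex.exp (-1 * Complex.I * phase lam x) = e' at hE ⊢
  linear_combination (5 * Complex.I * root lam * freqPoly lam⁻¹ (x : ℂ)⁻¹ *
    ampPoly lam⁻¹ (x : ℂ)⁻¹ ^ 2) * (e * e') * hc + (5 / 2 * Complex.I * root lam *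
    freqPoly lam⁻¹ (x : ℂ)⁻¹ * ampPoly lam⁻¹ (x : ℂ)⁻¹ ^ 2 * psiNum x) * hE

theorem modeWronskian_sub_isBigO (lam : ℂ) :
    (fun x => modeWronskian lam x - 5 / 2 * Complex.I * root lam) =O[atTop]
      fun x : ℝ => x ^ (-(7 / 2) : ℝ) := by
  have hF : ContinuousAt (fun q => freqPoly lam⁻¹ q * ampPoly lam⁻¹ q ^ 2) 0 :=
    (hasDerivAt_freqPoly _ 0).continuousAt.mul ((hasDerivAt_ampPoly _ 0).continuousAt.pow 2)
  have hG : ContinuousAt (wronskianQuot lam⁻¹) 0 := by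
    unfold wronskianQuot
    fun_prop
  have hg : (fun x => ((psiNum x - 1 : ℝ) : ℂ)) =O[atTop] fun x : ℝ => x ^ (-4 : ℝ) :=
    (IsBigO.of_bound 1 (Eventually.of_forall fun x => by rw [Complex.norm_real, one_mul])).trans
      (psiNum_sub_one_isBigO (s := 4) (by norm_num))
  have h1 := IsBigO.mul_rpow (r := -(7 / 2)) hg
    (isBigO_rpow_of_isBigO_one (comp_inv_isBigO_one hF)) (by norm_num)
  have h2 := IsBigO.mul_rpow (r := -(7 / 2)) (inv_pow_isBigO 4 (s := -4) (by norm_num))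
    (isBigO_rpow_of_isBigO_one (comp_inv_isBigO_one hG)) (by norm_num)
  refine ((h1.add h2).const_mul_left (5 / 2 * Complex.I * root lam)).congr' ?_ EventuallyEq.rfl
  filter_upwards [eventually_gt_atTop 0] with x hx
  rw [modeWronskian_eq lam hx]
  have := freqPoly_mul_ampPoly_sq lam⁻¹ (x : ℂ)⁻¹
  push_cast
  linear_combination (-(5 / 2 * Complex.I * root lam)) * this

theorem tendsto_freq_div (lam : ℂ) :
    Tendsto (fun x : ℝ => freq lam x / ((x ^ (3 / 2 : ℝ) : ℝ) : ℂ)) atTop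
      (𝓝 (root lam * (5 / 2))) := by
  have := (tendsto_freqPoly lam⁻¹).const_mul (root lam * (5 / 2))
  rw [mul_one] at this
  refine this.congr' ?_
  filter_upwards [eventually_gt_atTop 0] with x hx
  have : ((x ^ (3 / 2 : ℝ) : ℝ) : ℂ) ≠ 0 := by exact_mod_cast (Real.rpow_pos_of_pos hx _).ne'
  rw [freq]
  field_simp

theorem freq_inv_isBigO {lam : ℂ} (hlam : lam ≠ 0) :
    (fun x => (freq lam x)⁻¹) =O[atTop] fun x : ℝ => x ^ (-(3 / 2) : ℝ) := by
  have h := (tendsto_freq_div lam).inv₀ (mul_ne_zero (root_ne_zero hlam) (by norm_num))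
  have h2 := IsBigO.mul_rpow (r := -(3 / 2)) (isBigO_rpow_of_isBigO_one (h.isBigO_one ℝ))
    (ofReal_rpow_isBigO (-(3 / 2))) (by norm_num)
  refine h2.congr' ?_ EventuallyEq.rfl
  filter_upwards [eventually_gt_atTop 0] with x hx
  have : ((x ^ (3 / 2 : ℝ) : ℝ) : ℂ) ≠ 0 := by exact_mod_cast (Real.rpow_pos_of_pos hx _).ne'
  rw [Real.rpow_neg hx.le, Complex.ofReal_inv, inv_div]
  field_simp

/-- This quotient drives variation of constants. Integrating x^(-9/2) to infinity gives the rate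
x^(-7/2). -/
theorem residual_div_freq_isBigO {lam σ : ℂ} (hlam : lam ≠ 0) (hσ : σ ^ 2 = 1) :
    (fun x => residual lam σ x * (freq lam x)⁻¹) =O[atTop] fun x : ℝ => x ^ (-(9 / 2) : ℝ) :=
  IsBigO.mul_rpow (residual_isBigO hlam hσ) (freq_inv_isBigO hlam) (by norm_num)

theorem eventually_freq_ne_zero {lam : ℂ} (hlam : lam ≠ 0) :
    ∀ᶠ x : ℝ in atTop, freq lam x ≠ 0 := by
  filter_upwards [(tendsto_freq_div lam).eventually_ne
    (mul_ne_zero (root_ne_zero hlam) (by norm_num))] with x hx h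
  simp [h] at hx

theorem mode_ne_zero {lam : ℂ} (σ : ℂ) {x : ℝ} (hx : 0 < x)
    (hP : ampPoly lam⁻¹ (x : ℂ)⁻¹ ≠ 0) : mode lam σ x ≠ 0 := by
  rw [mode_eq, P0_eq_ampPoly]
  have : x ^ (-(1 / 4) : ℝ) * Real.exp (x ^ 2 / 2) ≠ 0 := by positivity
  exact mul_ne_zero (mul_ne_zero (by exact_mod_cast this) hP) (Complex.exp_ne_zero _)

/-! ### Variation of constants -/

/-- The Lagrange bracket of a solution `(u, f)` with the approximate solution `mode lam σ`. -/
noncomputable def bracket (lam σ : ℂ) (u f : ℝ → ℂ) (x : ℝ) : ℂ :=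
  f x * mode lam σ x - u x * modeFlux lam σ x

/-- Lagrange's identity: the bracket would be constant if the mode were an exact solution, so only
its residual survives. -/
theorem hasDerivAt_bracket {lam : ℂ} (hlam : lam ≠ 0) (σ : ℂ) {R : ℝ} {u f : ℝ → ℂ}
    (h : IsSystemSolution lam R u f) {x : ℝ} (hR : R < x) (hx : 0 < x)
    (hP : ampPoly lam⁻¹ (x : ℂ)⁻¹ ≠ 0) :
    HasDerivAt (bracket lam σ u f)
      (-((fluxCoeff x : ℂ) * residual lam σ x * mode lam σ x * u x)) x := by
  have hp : (fluxCoeff x : ℂ) ≠ 0 := by exact_mod_cast (fluxCoeff_pos hx).ne'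
  have h1 := ((h x hR).2.mul (hasDerivAt_mode hlam σ hx hP)).sub
    ((h x hR).1.mul (hasDerivAt_modeFlux hlam σ hx hP))
  refine h1.congr_deriv ?_
  rw [modeFlux]
  field_simp
  ring

/-- Cramer's rule: eliminating `f` from the two brackets recovers the solution, with brackets over
Wronskian as coefficients of the modes. -/
theorem bracket_mul_sub (lam : ℂ) (u f : ℝ → ℂ) (x : ℝ) :
    bracket lam (-1) u f x * mode lam 1 x - bracket lam 1 u f x * mode lam (-1) x =
      u x * modeWronskian lam x := by
  simp only [bracket, modeFlux, modeWronskian, modeLogDeriv]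
  ring

theorem bracket_linearCombination (lam σ c₁ c₂ : ℂ) (u₁ f₁ u₂ f₂ : ℝ → ℂ) (x : ℝ) :
    bracket lam σ (fun x => c₁ * u₁ x + c₂ * u₂ x) (fun x => c₁ * f₁ x + c₂ * f₂ x) x =
      c₁ * bracket lam σ u₁ f₁ x + c₂ * bracket lam σ u₂ f₂ x := by
  simp only [bracket]
  ring

theorem hasDerivAt_div_mode {lam : ℂ} (hlam : lam ≠ 0) (σ : ℂ) {R : ℝ} {u f : ℝ → ℂ}
    (h : IsSystemSolution lam R u f) {x : ℝ} (hR : R < x) (hx : 0 < x)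
    (hP : ampPoly lam⁻¹ (x : ℂ)⁻¹ ≠ 0) :
    HasDerivAt (fun x => u x / mode lam σ x)
      (bracket lam σ u f x / ((fluxCoeff x : ℂ) * mode lam σ x ^ 2)) x := by
  have hp : (fluxCoeff x : ℂ) ≠ 0 := by exact_mod_cast (fluxCoeff_pos hx).ne'
  have hz := mode_ne_zero σ hx hP
  refine ((h x hR).1.div (hasDerivAt_mode hlam σ hx hP) hz).congr_deriv ?_
  rw [bracket, modeFlux]
  field_simp

theorem tendsto_phase_div {lam : ℂ} (hlam : lam ≠ 0) :
    Tendsto (fun x : ℝ => phase lam x / ((x ^ (5 / 2 : ℝ) : ℝ) : ℂ)) atTop (𝓝 (root lam)) := by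
  have := (tendsto_comp_inv (hasDerivAt_phasePoly lam⁻¹ 0).continuousAt).const_mul (root lam)
  rw [show phasePoly lam⁻¹ 0 = 1 by simp [phasePoly], mul_one] at this
  refine this.congr' ?_
  filter_upwards [eventually_gt_atTop 0] with x hx
  have : ((x ^ (5 / 2 : ℝ) : ℝ) : ℂ) ≠ 0 := by exact_mod_cast (Real.rpow_pos_of_pos hx _).ne'
  rw [phase, P1_eq_phasePoly hlam]
  field_simp

theorem tendsto_phase_im {lam : ℂ} (hlam : lam ≠ 0) (hr : 0 < (root lam).im) :
    Tendsto (fun x => (phase lam x).im) atTop atTop := by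
  have h1 := (Complex.continuous_im.tendsto _).comp (tendsto_phase_div hlam)
  have h2 := h1.pos_mul_atTop hr (tendsto_rpow_atTop (y := 5 / 2) (by norm_num))
  refine h2.congr' ?_
  filter_upwards [eventually_gt_atTop 0] with x hx
  simp only [Function.comp_apply, Complex.div_ofReal_im]
  have := (Real.rpow_pos_of_pos hx (5 / 2)).ne'
  field_simp

theorem tendsto_phase_re {lam : ℂ} (hlam : lam ≠ 0) (hr : 0 < (root lam).re) :
    Tendsto (fun x => (phase lam x).re) atTop atTop := by
  have h1 := (Complex.continuous_re.tendsto _).comp (tendsto_phase_div hlam)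
  have h2 := h1.pos_mul_atTop hr (tendsto_rpow_atTop (y := 5 / 2) (by norm_num))
  refine h2.congr' ?_
  filter_upwards [eventually_gt_atTop 0] with x hx
  simp only [Function.comp_apply, Complex.div_ofReal_re]
  have := (Real.rpow_pos_of_pos hx (5 / 2)).ne'
  field_simp

theorem eventually_freq_im_ge {lam : ℂ} (hr : 0 < (root lam).im) :
    ∀ᶠ x : ℝ in atTop, 2 * (root lam).im * x ^ (3 / 2 : ℝ) ≤ (freq lam x).im := by
  have h1 := (Complex.continuous_im.tendsto _).comp (tendsto_freq_div lam)
  -- The limiting factor is 5/2. The smaller value 2 leaves room for the lower-order terms.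
  have h2 : 2 * (root lam).im < (root lam * (5 / 2)).im := by
    have : (root lam * (5 / 2)).im = (root lam).im * (5 / 2) := by
      simp [Complex.mul_im]
    rw [this]
    linarith
  filter_upwards [h1.eventually (lt_mem_nhds h2), eventually_gt_atTop 0] with x hx hx0
  simp only [Function.comp_apply, Complex.div_ofReal_im] at hx
  rw [lt_div_iff₀ (Real.rpow_pos_of_pos hx0 _)] at hx
  exact hx.le

/-- The ratio `mode lam 1 / mode lam (-1)`. -/
noncomputable def modeRatio (lam : ℂ) (x : ℝ) : ℂ := Complex.exp (2 * Complex.I * phase lam x)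

theorem norm_modeRatio (lam : ℂ) (x : ℝ) :
    ‖modeRatio lam x‖ = Real.exp (-2 * (phase lam x).im) := by
  rw [modeRatio, Complex.norm_exp]
  simp [Complex.mul_re]

theorem modeRatio_ne_zero (lam : ℂ) (x : ℝ) : modeRatio lam x ≠ 0 := Complex.exp_ne_zero _

theorem hasDerivAt_modeRatio {lam : ℂ} (hlam : lam ≠ 0) {x : ℝ} (hx : 0 < x) :
    HasDerivAt (modeRatio lam) (2 * Complex.I * freq lam x * modeRatio lam x) x := by
  refine ((hasDerivAt_phase hlam hx).const_mul (2 * Complex.I)).cexp.congr_deriv ?_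
  rw [modeRatio]
  ring

theorem hasDerivAt_exp_phase_im {lam : ℂ} (hlam : lam ≠ 0) (c : ℝ) {x : ℝ} (hx : 0 < x) :
    HasDerivAt (fun x => Real.exp (c * (phase lam x).im))
      (c * (freq lam x).im * Real.exp (c * (phase lam x).im)) x := by
  have h1 : HasDerivAt (fun x => (phase lam x).im) (freq lam x).im x :=
    Complex.imCLM.hasFDerivAt.comp_hasDerivAt x (hasDerivAt_phase hlam hx)
  refine (h1.const_mul c).exp.congr_deriv ?_
  ring

theorem tendsto_modeWronskian (lam : ℂ) :
    Tendsto (modeWronskian lam) atTop (𝓝 (5 / 2 * Complex.I * root lam)) := by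
  have h := (modeWronskian_sub_isBigO lam).trans_tendsto (tendsto_rpow_neg_atTop (by norm_num))
  simpa using h.add_const (5 / 2 * Complex.I * root lam)

theorem wronskianLimit_ne_zero {lam : ℂ} (hlam : lam ≠ 0) : 5 / 2 * Complex.I * root lam ≠ 0 :=
  mul_ne_zero (mul_ne_zero (by norm_num) Complex.I_ne_zero) (root_ne_zero hlam)

/-- The leading coefficient times the square of the second approximate solution. -/
theorem fluxCoeff_mul_mode_sq (lam : ℂ) (x : ℝ) :
    (fluxCoeff x : ℂ) * mode lam (-1) x ^ 2 * (2 * Complex.I * freq lam x * modeRatio lam x) =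
      modeWronskian lam x := by
  rw [modeWronskian, mode_one_eq, modeRatio]
  ring

/-! ### Growing and decaying solutions -/

theorem eventually_norm_modeWronskian {lam : ℂ} (hlam : lam ≠ 0) :
    ∀ᶠ x in atTop, ‖5 / 2 * Complex.I * root lam‖ / 2 ≤ ‖modeWronskian lam x‖ ∧
      ‖modeWronskian lam x‖ ≤ 2 * ‖5 / 2 * Complex.I * root lam‖ := by
  have hk := norm_pos_iff.2 (wronskianLimit_ne_zero hlam)
  have h := (tendsto_modeWronskian lam).norm
  filter_upwards [h.eventually (lt_mem_nhds (half_lt_self hk)),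
    h.eventually (gt_mem_nhds (lt_two_mul_self hk))] with x h1 h2 using ⟨h1.le, h2.le⟩

/-! ### Calculus of limits with error O(x^(-7/2)) -/

/-- `f` tends to `a` at infinity with rate `x ^ (-7/2)`. -/
def HasRateLimit (f : ℝ → ℂ) (a : ℂ) : Prop :=
  (fun x => f x - a) =O[atTop] fun x : ℝ => x ^ (-(7 / 2) : ℝ)

theorem HasRateLimit.tendsto {f : ℝ → ℂ} {a : ℂ} (h : HasRateLimit f a) :
    Tendsto f atTop (𝓝 a) := by
  simpa using (IsBigO.trans_tendsto h (tendsto_rpow_neg_atTop (by norm_num))).add_const a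

theorem HasRateLimit.mul {f g : ℝ → ℂ} {a b : ℂ} (hf : HasRateLimit f a)
    (hg : HasRateLimit g b) : HasRateLimit (fun x => f x * g x) (a * b) := by
  have h1 := (hf.tendsto.isBigO_one ℝ).mul hg
  simp only [one_mul] at h1
  refine (h1.add (IsBigO.const_mul_left hf b)).congr_left fun x => ?_
  ring

theorem hasRateLimit_const (a : ℂ) : HasRateLimit (fun _ => a) a := by
  simp only [HasRateLimit, sub_self]
  exact isBigO_zero _ _

theorem HasRateLimit.const_mul {f : ℝ → ℂ} {a : ℂ} (hf : HasRateLimit f a) (c : ℂ) :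
    HasRateLimit (fun x => c * f x) (c * a) :=
  (hasRateLimit_const c).mul hf

theorem HasRateLimit.inv {f : ℝ → ℂ} {a : ℂ} (hf : HasRateLimit f a) (ha : a ≠ 0) :
    HasRateLimit (fun x => (f x)⁻¹) a⁻¹ := by
  have h1 := ((hf.tendsto.inv₀ ha).isBigO_one ℝ).mul hf
  simp only [one_mul] at h1
  refine (h1.const_mul_left (-a⁻¹)).congr' ?_ EventuallyEq.rfl
  filter_upwards [hf.tendsto.eventually_ne ha] with x hx
  field_simp
  ring

theorem HasRateLimit.div {f g : ℝ → ℂ} {a b : ℂ} (hf : HasRateLimit f a)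
    (hg : HasRateLimit g b) (hb : b ≠ 0) : HasRateLimit (fun x => f x / g x) (a / b) := by
  simp only [div_eq_mul_inv]
  exact hf.mul (hg.inv hb)

theorem HasRateLimit.congr {f g : ℝ → ℂ} {a : ℂ} (hf : HasRateLimit f a)
    (h : ∀ᶠ x in atTop, f x = g x) : HasRateLimit g a :=
  IsBigO.congr' hf (h.mono fun x hx => by simp only [hx]) EventuallyEq.rfl

theorem hasRateLimit_modeWronskian (lam : ℂ) :
    HasRateLimit (modeWronskian lam) (5 / 2 * Complex.I * root lam) :=
  modeWronskian_sub_isBigO lam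

theorem HasRateLimit.hasModeForm {lam σ : ℂ} {u : ℝ → ℂ}
    (h : HasRateLimit (fun x => u x / mode lam σ x) 1) : HasModeForm lam σ u := by
  refine ⟨fun x => u x / mode lam σ x - 1, h, ?_⟩
  filter_upwards [eventually_gt_atTop 0, eventually_ampPoly_ne_zero lam⁻¹] with x hx hP
  have := mode_ne_zero σ hx hP
  field_simp
  ring

/-- Set H = u / z₋ and K = `bracket lam (-1) u f`, so that H' = K / (p z₋²). While |H| ≤ N, the
derivative of K is O(N x^(-9/2) e^(2 Im φ)). Integrating the growing exponential gains x^(-3/2), so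
K = O(N x^(-6) e^(2 Im φ)), and division by p z₋² leaves H' = O(N x^(-9/2)). The past-supremum lemma
then gives a limit of H close to its initial value 1, hence nonzero. -/
theorem exists_dominant {lam : ℂ} (hlam : lam ≠ 0) (hr : 0 < (root lam).im) :
    ∃ (u f : ℝ → ℂ) (l : ℂ) (X : ℝ), 0 < X ∧ u X ≠ 0 ∧ IsSystemSolution lam 0 u f ∧ l ≠ 0 ∧
      (fun x => u x / mode lam (-1) x - l) =O[atTop] fun x : ℝ => x ^ (-(7 / 2) : ℝ) := by
  obtain ⟨C₁, hC₁, hb₁⟩ := (residual_div_freq_isBigO (σ := -1) hlam (by norm_num)).exists_pos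
  obtain ⟨C₂, hC₂, hb₂⟩ := (freq_isBigO lam).exists_pos
  have hk := norm_pos_iff.2 (wronskianLimit_ne_zero hlam)
  set κ := ‖5 / 2 * Complex.I * root lam‖ with hκ
  set c := (root lam).im with hc
  -- The condition 6 x^(-5/2) ≤ 3c absorbs the derivative of x^(-6) in the comparison function for
  -- the bracket. The last condition is the smallness required by `exists_tendsto_of_deriv_le_past`.
  have hall : ∀ᶠ x : ℝ in atTop, 1 ≤ x ∧ ampPoly lam⁻¹ (x : ℂ)⁻¹ ≠ 0 ∧ freq lam x ≠ 0 ∧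
      ‖residual lam (-1) x * (freq lam x)⁻¹‖ ≤ C₁ * x ^ (-(9 / 2) : ℝ) ∧
      ‖freq lam x‖ ≤ C₂ * x ^ (3 / 2 : ℝ) ∧ 2 * c * x ^ (3 / 2 : ℝ) ≤ (freq lam x).im ∧
      (κ / 2 ≤ ‖modeWronskian lam x‖ ∧ ‖modeWronskian lam x‖ ≤ 2 * κ) ∧
      6 * x ^ (-(5 / 2) : ℝ) ≤ 3 * c ∧
      (4 * (κ * C₁ / c) * C₂ / κ) / (7 / 2) * x ^ (-(7 / 2) : ℝ) ≤ 1 / 4 := by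
    filter_upwards [eventually_ge_atTop 1, eventually_ampPoly_ne_zero lam⁻¹,
      eventually_freq_ne_zero hlam, hb₁.bound, hb₂.bound, eventually_freq_im_ge hr,
      eventually_norm_modeWronskian hlam,
      eventually_mul_rpow_neg_le 6 (by norm_num : (0 : ℝ) < 5 / 2)
        (by positivity : (0 : ℝ) < 3 * c),
      eventually_mul_rpow_neg_le ((4 * (κ * C₁ / c) * C₂ / κ) / (7 / 2))
        (by norm_num : (0 : ℝ) < 7 / 2) (by norm_num : (0 : ℝ) < 1 / 4)]
      with x h1 h2 h3 h4 h5 h6 h7 h8 h9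
    rw [Real.norm_of_nonneg (Real.rpow_nonneg (by linarith) _)] at h4 h5
    exact ⟨h1, h2, h3, h4, h5, h6, h7, h8, h9⟩
  obtain ⟨X, hX⟩ := eventually_atTop.1 hall
  have hX0 : 0 < X := one_pos.trans_le (hX X le_rfl).1
  -- Matching both the value and the flux of the mode at X makes the bracket start from zero, so no
  -- initial term has to be carried along.
  obtain ⟨u, f, hsol, huX, hfX⟩ := exists_isSystemSolution lam hX0 (mode lam (-1) X)
    (modeFlux lam (-1) X)
  have hzX : mode lam (-1) X ≠ 0 := mode_ne_zero _ hX0 (hX X le_rfl).2.1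
  have hKX : bracket lam (-1) u f X = 0 := by
    rw [bracket, huX, hfX]
    ring
  have hHX : u X / mode lam (-1) X = 1 := by
    rw [huX]
    exact div_self hzX
  have hp : ∀ x, X ≤ x → 0 < x := fun x hx => hX0.trans_le hx
  -- the reciprocal of `p z²`
  have hpz : ∀ x, X ≤ x → (fluxCoeff x : ℂ) * mode lam (-1) x ^ 2 =
      modeWronskian lam x / (2 * Complex.I * freq lam x * modeRatio lam x) := by
    intro x hx
    rw [← fluxCoeff_mul_mode_sq, mul_div_assoc, div_self, mul_one]
    exact mul_ne_zero (mul_ne_zero (mul_ne_zero two_ne_zero Complex.I_ne_zero) (hX x hx).2.2.1)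
      (modeRatio_ne_zero lam x)
  have hE : ∀ x, ‖modeRatio lam x‖ = (Real.exp (2 * (phase lam x).im))⁻¹ := by
    intro x
    rw [norm_modeRatio, ← Real.exp_neg]
    ring_nf
  have key := exists_tendsto_of_deriv_le_past (s := 7 / 2) (by norm_num) hX0
    (C := 4 * (κ * C₁ / c) * C₂ / κ) (by positivity) (hX X le_rfl).2.2.2.2.2.2.2.2
    (h := fun x => u x / mode lam (-1) x)
    (fun x hx => hasDerivAt_div_mode hlam (-1) hsol (hp x hx) (hp x hx) (hX x hx).2.1) ?_
  · obtain ⟨l, _, hl, hl1⟩ := key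
    refine ⟨u, f, l, X, hX0, by rwa [huX], hsol, ?_, hl⟩
    rintro rfl
    norm_num [hHX] at hl1
  · intro Y N hY hN
    have hN0 : 0 ≤ N := (norm_nonneg _).trans (hN X (left_mem_Icc.2 hY))
    have hK : ‖bracket lam (-1) u f Y‖ ≤
        N * (κ * C₁ / c) * Y ^ (-6 : ℝ) * Real.exp (2 * (phase lam Y).im) := by
      have h1 := norm_sub_le_of_hasDerivAt hY
        (h := bracket lam (-1) u f)
        (B := fun x => N * (κ * C₁ / c) * (x ^ (-6 : ℝ) * Real.exp (2 * (phase lam x).im)))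
        (fun x hx => hasDerivAt_bracket hlam (-1) hsol (hp x hx.1) (hp x hx.1) (hX x hx.1).2.1)
        (fun x hx => ((Real.hasDerivAt_rpow_const (p := -6) (Or.inl (hp x hx.1).ne')).mul
          (hasDerivAt_exp_phase_im hlam 2 (hp x hx.1))).const_mul (N * (κ * C₁ / c))) ?_
      · rw [hKX, sub_zero] at h1
        have h2 : 0 ≤ N * (κ * C₁ / c) * (X ^ (-6 : ℝ) * Real.exp (2 * (phase lam X).im)) := by
          positivity
        linarith
      · intro x hx
        obtain ⟨hx1, hP, hf0, hres, hfreq, him, hW, h6, -⟩ := hX x hx.1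
        have hx0 := hp x hx.1
        have hz := mode_ne_zero (-1) hx0 hP
        have e1 : (fluxCoeff x : ℂ) * residual lam (-1) x * mode lam (-1) x * u x =
            modeWronskian lam x / (2 * Complex.I * modeRatio lam x) *
              (residual lam (-1) x * (freq lam x)⁻¹) * (u x / mode lam (-1) x) := by
          have := hpz x hx.1
          have hR := modeRatio_ne_zero lam x
          have hI := Complex.I_ne_zero
          calc _ = (fluxCoeff x * mode lam (-1) x ^ 2) * residual lam (-1) x *
                (u x / mode lam (-1) x) := by field_simp
            _ = _ := by rw [this]; field_simp
        have e2 : ‖(2 : ℂ) * Complex.I * modeRatio lam x‖ =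
            2 * (Real.exp (2 * (phase lam x).im))⁻¹ := by
          rw [norm_mul, norm_mul, hE, Complex.norm_I]
          simp
        rw [norm_neg, e1, norm_mul, norm_mul, norm_div, e2]
        set e := Real.exp (2 * (phase lam x).im)
        have he : 0 < e := Real.exp_pos _
        have e3 : x ^ (-6 - 1 : ℝ) = x ^ (-(9 / 2) : ℝ) * x ^ (-(5 / 2) : ℝ) := by
          rw [← Real.rpow_add hx0]
          norm_num
        have e4 : x ^ (-(9 / 2) : ℝ) = x ^ (-6 : ℝ) * x ^ (3 / 2 : ℝ) := by
          rw [← Real.rpow_add hx0]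
          norm_num
        have e5 : 0 < x ^ (-6 : ℝ) := Real.rpow_pos_of_pos hx0 _
        have e6 : 0 < x ^ (3 / 2 : ℝ) := Real.rpow_pos_of_pos hx0 _
        calc ‖modeWronskian lam x‖ / (2 * e⁻¹) * ‖residual lam (-1) x * (freq lam x)⁻¹‖ *
              ‖u x / mode lam (-1) x‖
            ≤ (2 * κ) / (2 * e⁻¹) * (C₁ * x ^ (-(9 / 2) : ℝ)) * N := by
              gcongr
              · exact hW.2
              · exact hN x hx
          _ = N * (κ * C₁ / c) * (c * x ^ (-(9 / 2) : ℝ) * e) := by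
              field_simp
          _ ≤ N * (κ * C₁ / c) * (-6 * x ^ (-6 - 1 : ℝ) * e +
              x ^ (-6 : ℝ) * (2 * (freq lam x).im * e)) := by
              gcongr
              rw [e3]
              have h1 : x ^ (-(9 / 2) : ℝ) * (6 * x ^ (-(5 / 2) : ℝ)) ≤
                  x ^ (-(9 / 2) : ℝ) * (3 * c) := by gcongr
              have h2 : x ^ (-6 : ℝ) * (2 * c * x ^ (3 / 2 : ℝ)) ≤
                  x ^ (-6 : ℝ) * (freq lam x).im := by gcongr
              have h3 : c * x ^ (-(9 / 2) : ℝ) ≤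
                  -6 * (x ^ (-(9 / 2) : ℝ) * x ^ (-(5 / 2) : ℝ)) +
                    x ^ (-6 : ℝ) * (2 * (freq lam x).im) := by
                have h4 : x ^ (-6 : ℝ) * (2 * c * x ^ (3 / 2 : ℝ)) =
                    2 * (c * x ^ (-(9 / 2) : ℝ)) := by
                  rw [e4]
                  ring
                linarith
              have := mul_le_mul_of_nonneg_right h3 he.le
              linarith
    obtain ⟨hx1, hP, hf0, hres, hfreq, him, hW, h6, -⟩ := hX Y hY
    have hY0 := hp Y hY
    set e := Real.exp (2 * (phase lam Y).im) with he'
    have he : 0 < e := Real.exp_pos _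
    have e4 : Y ^ (-(7 / 2) - 1 : ℝ) = Y ^ (-6 : ℝ) * Y ^ (3 / 2 : ℝ) := by
      rw [← Real.rpow_add hY0]
      norm_num
    have hWpos : 0 < ‖modeWronskian lam Y‖ := lt_of_lt_of_le (by positivity) hW.1
    rw [hpz Y hY, norm_div, norm_div, norm_mul, norm_mul, norm_mul, hE, Complex.norm_I, ← he', e4,
      div_div_eq_mul_div]
    simp only [Complex.norm_ofNat, mul_one]
    calc ‖bracket lam (-1) u f Y‖ * (2 * ‖freq lam Y‖ * e⁻¹) / ‖modeWronskian lam Y‖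
        ≤ (N * (κ * C₁ / c) * Y ^ (-6 : ℝ) * e) * (2 * (C₂ * Y ^ (3 / 2 : ℝ)) * e⁻¹) /
          (κ / 2) := by
          gcongr
          exact hW.1
      _ = _ := by
          field_simp
          ring

/-- The Wronskian of two solutions is constant. -/
theorem IsSystemSolution.wronskian_eq {lam : ℂ} {R : ℝ} (hR : 0 ≤ R) {u f v g : ℝ → ℂ}
    (hu : IsSystemSolution lam R u f) (hv : IsSystemSolution lam R v g) {x y : ℝ} (hx : R < x)
    (hxy : x ≤ y) : g y * u y - v y * f y = g x * u x - v x * f x := by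
  have h := norm_sub_le_of_hasDerivAt hxy (h := fun x => g x * u x - v x * f x) (h' := fun _ => 0)
    (B := fun _ => 0) (B' := fun _ => 0) (fun t ht => ?_) (fun t _ => hasDerivAt_const t _)
    (fun t _ => by simp)
  · simpa [sub_eq_zero] using h
  · have ht' := hx.trans_le ht.1
    have hp : (fluxCoeff t : ℂ) ≠ 0 := by exact_mod_cast (fluxCoeff_pos (hR.trans_lt ht')).ne'
    refine (((hv t ht').2.mul (hu t ht').1).sub ((hv t ht').1.mul (hu t ht').2)).congr_deriv ?_
    field_simp
    ring

/-- Reduction of order. For a second solution v, (v/u)' is a constant over p u², which equals D E'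
with E = `modeRatio lam` and D → κ at rate x^(-7/2). Thus v/u - κE has a limit m, approached with
error O(x^(-7/2) |E|), and (v - m u)/κ is asymptotic to u E. -/
theorem exists_recessive {lam : ℂ} (hlam : lam ≠ 0) (hr : 0 < (root lam).im) {u f : ℝ → ℂ}
    {l : ℂ} {X : ℝ} (hX : 0 < X) (huX : u X ≠ 0) (hsol : IsSystemSolution lam 0 u f) (hl : l ≠ 0)
    (hu : HasRateLimit (fun x => u x / mode lam (-1) x) l) :
    ∃ v g : ℝ → ℂ, IsSystemSolution lam 0 v g ∧
      HasRateLimit (fun x => v x / u x / modeRatio lam x) 1 := by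
  -- These initial values give the Wronskian of u and v the value u X, which is nonzero.
  obtain ⟨v, g, hv, hvX, hgX⟩ := exists_isSystemSolution lam hX 0 1
  set k := 5 / 2 * Complex.I * root lam with hk
  have hk0 : k ≠ 0 := wronskianLimit_ne_zero hlam
  have hW : ∀ x, X ≤ x → g x * u x - v x * f x = u X := by
    intro x hx
    rw [hsol.wronskian_eq le_rfl hv hX hx, hvX, hgX]
    ring
  have hD := (hasRateLimit_const (u X)).div
    ((hasRateLimit_modeWronskian lam).mul (hu.mul hu)) (mul_ne_zero hk0 (mul_ne_zero hl hl))
  set D := fun x => u X / (modeWronskian lam x *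
    (u x / mode lam (-1) x * (u x / mode lam (-1) x))) with hDdef
  set κ := u X / (k * (l * l)) with hκ
  have hκ0 : κ ≠ 0 := div_ne_zero huX (mul_ne_zero hk0 (mul_ne_zero hl hl))
  obtain ⟨C₁, hC₁, hb₁⟩ := IsBigO.exists_pos hD
  obtain ⟨C₂, hC₂, hb₂⟩ := (freq_isBigO lam).exists_pos
  set c := (root lam).im with hc
  have hall : ∀ᶠ x : ℝ in atTop, (X ≤ x ∧ 1 ≤ x) ∧ ampPoly lam⁻¹ (x : ℂ)⁻¹ ≠ 0 ∧ u x ≠ 0 ∧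
      ‖D x - κ‖ ≤ C₁ * x ^ (-(7 / 2) : ℝ) ∧
      ‖freq lam x‖ ≤ C₂ * x ^ (3 / 2 : ℝ) ∧ 2 * c * x ^ (3 / 2 : ℝ) ≤ (freq lam x).im ∧
      freq lam x ≠ 0 := by
    filter_upwards [eventually_ge_atTop X, eventually_ge_atTop 1,
      eventually_ampPoly_ne_zero lam⁻¹, hu.tendsto.eventually_ne hl, hb₁.bound, hb₂.bound,
      eventually_freq_im_ge hr, eventually_freq_ne_zero hlam] with x h1 h1' h2 h3 h4 h5 h6 h7
    rw [Real.norm_of_nonneg (Real.rpow_nonneg (by linarith) _)] at h4 h5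
    exact ⟨⟨h1, h1'⟩, h2, fun h => h3 (by simp [h]), h4, h5, h6, h7⟩
  obtain ⟨Y, hY⟩ := eventually_atTop.1 hall
  have hp : ∀ x, Y ≤ x → 0 < x := fun x hx => one_pos.trans_le (hY x hx).1.2
  set η := fun x => Real.exp (-2 * (phase lam x).im) with hη
  have hηpos : ∀ x, 0 < η x := fun x => Real.exp_pos _
  have hη0 : Tendsto η atTop (𝓝 0) := by
    refine Real.tendsto_exp_atBot.comp ?_
    exact (tendsto_phase_im hlam hr).const_mul_atTop_of_neg (by norm_num)
  have hderiv : ∀ x, Y ≤ x → HasDerivAt (fun x => v x / u x - κ * modeRatio lam x)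
      ((D x - κ) * (2 * Complex.I * freq lam x * modeRatio lam x)) x := by
    intro x hx
    obtain ⟨hx1, hP, hux, -, -, -, hf0⟩ := hY x hx
    have hx0 := hp x hx
    have hp0 : (fluxCoeff x : ℂ) ≠ 0 := by exact_mod_cast (fluxCoeff_pos hx0).ne'
    have hz := mode_ne_zero (-1) hx0 hP
    refine (((hv x hx0).1.div (hsol x hx0).1 hux).sub
      ((hasDerivAt_modeRatio hlam hx0).const_mul κ)).congr_deriv ?_
    have h1 : D x * (2 * Complex.I * freq lam x * modeRatio lam x) =
        u X / (fluxCoeff x * u x ^ 2) := by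
      have hR := modeRatio_ne_zero lam x
      have hI := Complex.I_ne_zero
      simp only [hDdef]
      rw [← fluxCoeff_mul_mode_sq]
      field_simp
    rw [sub_mul, h1, ← hW x hx1.1]
    field_simp
  -- The power is frozen at the left end x. Since 2c t^(3/2) ≤ Im φ', the rest of the integrand is
  -- dominated by the exact derivative of -e^(-2 Im φ), so no exponential decay is lost.
  have hinc : ∀ x y, Y ≤ x → x ≤ y →
      ‖(v y / u y - κ * modeRatio lam y) - (v x / u x - κ * modeRatio lam x)‖ ≤
        C₁ * C₂ / (2 * c) * x ^ (-(7 / 2) : ℝ) * η x := by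
    intro x y hx hxy
    have hx0 := hp x hx
    have h1 := norm_sub_le_of_hasDerivAt hxy (fun t ht => hderiv t (hx.trans ht.1))
      (fun t ht => (hasDerivAt_exp_phase_im hlam (-2) (hp t (hx.trans ht.1))).const_mul
        (-(C₁ * C₂ / (2 * c) * x ^ (-(7 / 2) : ℝ)))) ?_
    · refine h1.trans ?_
      have h2 : 0 ≤ C₁ * C₂ / (2 * c) * x ^ (-(7 / 2) : ℝ) * η y := by
        have := hηpos y
        positivity
      simp only [hη] at h2 ⊢
      linarith
    · intro t ht
      obtain ⟨-, -, -, hDt, hft, him, -⟩ := hY t (hx.trans ht.1)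
      have ht0 := hp t (hx.trans ht.1)
      have hst : t ^ (-(7 / 2) : ℝ) ≤ x ^ (-(7 / 2) : ℝ) :=
        Real.rpow_le_rpow_of_nonpos hx0 ht.1 (by norm_num)
      rw [norm_mul, norm_mul, norm_mul, norm_modeRatio, norm_mul, Complex.norm_I]
      simp only [Complex.norm_ofNat, mul_one]
      have hs := Real.rpow_pos_of_pos ht0 (3 / 2)
      set e := Real.exp (-2 * (phase lam t).im)
      have he : 0 < e := Real.exp_pos _
      calc ‖D t - κ‖ * (2 * ‖freq lam t‖ * e)
          ≤ (C₁ * x ^ (-(7 / 2) : ℝ)) * (2 * (C₂ * t ^ (3 / 2 : ℝ)) * e) := by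
            gcongr
            exact hDt.trans (by gcongr)
        _ = C₁ * C₂ / (2 * c) * x ^ (-(7 / 2) : ℝ) * (2 * e) * (2 * c * t ^ (3 / 2 : ℝ)) := by
            field_simp
        _ ≤ C₁ * C₂ / (2 * c) * x ^ (-(7 / 2) : ℝ) * (2 * e) * (freq lam t).im := by gcongr
        _ = _ := by ring
  have hβ : Tendsto (fun x => C₁ * C₂ / (2 * c) * x ^ (-(7 / 2) : ℝ) * η x) atTop (𝓝 0) := by
    have := ((tendsto_rpow_neg_atTop (y := 7 / 2) (by norm_num)).const_mul
      (C₁ * C₂ / (2 * c))).mul hη0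
    simpa using this
  obtain ⟨m, -, hm⟩ := exists_tendsto_of_increment_le hβ hinc
  refine ⟨_, _, hv.linearCombination hsol κ⁻¹ (-m * κ⁻¹), ?_⟩
  refine IsBigO.of_bound (C₁ * C₂ / (2 * c) / ‖κ‖) ?_
  filter_upwards [eventually_ge_atTop Y] with x hx
  have hux := (hY x hx).2.2.1
  have hR := modeRatio_ne_zero lam x
  rw [Real.norm_of_nonneg (Real.rpow_nonneg (hp x hx).le _)]
  have h1 : (κ⁻¹ * v x + -m * κ⁻¹ * u x) / u x / modeRatio lam x - 1 =
      (v x / u x - κ * modeRatio lam x - m) / (κ * modeRatio lam x) := by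
    field_simp
    ring
  rw [h1, norm_div, norm_mul, norm_modeRatio]
  have h2 := hm x hx
  simp only [hη] at h2
  have h3 : 0 < Real.exp (-2 * (phase lam x).im) := Real.exp_pos _
  have h4 := norm_pos_iff.2 hκ0
  rw [div_le_iff₀ (by positivity)]
  refine h2.trans (le_of_eq ?_)
  field_simp

theorem exists_modes_of_im_pos {lam : ℂ} (hlam : lam ≠ 0) (hr : 0 < (root lam).im) :
    ∃ u f v g : ℝ → ℂ, IsSystemSolution lam 0 u f ∧ IsSystemSolution lam 0 v g ∧
      HasModeForm lam 1 u ∧ HasModeForm lam (-1) v := by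
  obtain ⟨u, f, l, X, hX, huX, hsol, hl, hu⟩ := exists_dominant hlam hr
  obtain ⟨v, g, hv, hvu⟩ := exists_recessive hlam hr hX huX hsol hl hu
  have hu' : HasRateLimit (fun x => u x / mode lam (-1) x) l := hu
  refine ⟨_, _, _, _, hv.linearCombination hsol l⁻¹ 0, hsol.linearCombination hv l⁻¹ 0,
    HasRateLimit.hasModeForm ?_, HasRateLimit.hasModeForm ?_⟩
  · have h := (hvu.mul hu').const_mul l⁻¹
    rw [one_mul, inv_mul_cancel₀ hl] at h
    refine h.congr ?_
    filter_upwards [hu'.tendsto.eventually_ne hl] with x hx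
    have hux : u x ≠ 0 := fun h => hx (by simp [h])
    rw [mode_one_eq, ← modeRatio]
    have := modeRatio_ne_zero lam x
    have : mode lam (-1) x ≠ 0 := fun h => hx (by simp [h])
    field_simp
    ring
  · have h := hu'.const_mul l⁻¹
    rw [inv_mul_cancel₀ hl] at h
    refine h.congr (Eventually.of_forall fun x => ?_)
    ring

/-! ### Oscillating solutions -/

theorem norm_modeRatio_of_im_eq_zero {lam : ℂ} {x : ℝ} (h : (phase lam x).im = 0) :
    ‖modeRatio lam x‖ = 1 := by
  rw [norm_modeRatio, h]
  simp

/-- With |z₊/z₋| = 1, expressing u by the brackets turns their derivatives into (residual /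
frequency) times a bounded combination of the brackets. The pair is therefore governed by the
past-supremum lemma, whose bound also shows that zero limits force zero data at X. -/
theorem exists_bracket_limit {lam : ℂ} (hlam : lam ≠ 0) (him : ∀ x, (phase lam x).im = 0)
    {R : ℝ} (hR : 0 ≤ R) {u f : ℝ → ℂ} (h : IsSystemSolution lam R u f) :
    ∃ la lb : ℂ, HasRateLimit (bracket lam (-1) u f) la ∧ HasRateLimit (bracket lam 1 u f) lb ∧
      (la = 0 → lb = 0 → ∀ x, R < x → u x = 0 ∧ f x = 0) := by
  obtain ⟨C₁, hC₁, hb₁⟩ := (residual_div_freq_isBigO (σ := -1) hlam (by norm_num)).exists_pos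
  obtain ⟨C₂, hC₂, hb₂⟩ := (residual_div_freq_isBigO (σ := 1) hlam (by norm_num)).exists_pos
  have hk := norm_pos_iff.2 (wronskianLimit_ne_zero hlam)
  have hall : ∀ᶠ x : ℝ in atTop, R + 1 ≤ x ∧ ampPoly lam⁻¹ (x : ℂ)⁻¹ ≠ 0 ∧ freq lam x ≠ 0 ∧
      ‖residual lam (-1) x * (freq lam x)⁻¹‖ ≤ C₁ * x ^ (-(9 / 2) : ℝ) ∧
      ‖residual lam 1 x * (freq lam x)⁻¹‖ ≤ C₂ * x ^ (-(9 / 2) : ℝ) ∧ modeWronskian lam x ≠ 0 ∧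
      (max C₁ C₂) / (7 / 2) * x ^ (-(7 / 2) : ℝ) ≤ 1 / 4 := by
    filter_upwards [eventually_ge_atTop (R + 1), eventually_ampPoly_ne_zero lam⁻¹,
      eventually_freq_ne_zero hlam, hb₁.bound, hb₂.bound, eventually_norm_modeWronskian hlam,
      eventually_mul_rpow_neg_le ((max C₁ C₂) / (7 / 2)) (by norm_num : (0 : ℝ) < 7 / 2)
        (by norm_num : (0 : ℝ) < 1 / 4)] with x h1 h2 h3 h4 h5 h6 h7
    rw [Real.norm_of_nonneg (Real.rpow_nonneg (by linarith) _)] at h4 h5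
    exact ⟨h1, h2, h3, h4, h5, norm_pos_iff.1 (lt_of_lt_of_le (by positivity) h6.1), h7⟩
  obtain ⟨X, hX⟩ := eventually_atTop.1 hall
  have hXR : R < X := by linarith [(hX X le_rfl).1]
  have hX0 : 0 < X := hR.trans_lt hXR
  have key := exists_tendsto_of_deriv_le_past (s := 7 / 2) (by norm_num) hX0
    (C := max C₁ C₂) (by positivity) (hX X le_rfl).2.2.2.2.2.2
    (h := fun x => (bracket lam (-1) u f x, bracket lam 1 u f x))
    (fun x hx => (hasDerivAt_bracket hlam (-1) h (hXR.trans_le hx) (hX0.trans_le hx)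
      (hX x hx).2.1).prodMk (hasDerivAt_bracket hlam 1 h (hXR.trans_le hx) (hX0.trans_le hx)
      (hX x hx).2.1)) ?_
  · obtain ⟨l, -, hl, hl1⟩ := key
    refine ⟨l.1, l.2, ?_, ?_, ?_⟩
    · exact (IsBigO.of_bound 1 (Eventually.of_forall fun x => by
        rw [one_mul]
        exact norm_fst_le ((bracket lam (-1) u f x, bracket lam 1 u f x) - l))).trans hl
    · exact (IsBigO.of_bound 1 (Eventually.of_forall fun x => by
        rw [one_mul]
        exact norm_snd_le ((bracket lam (-1) u f x, bracket lam 1 u f x) - l))).trans hl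
    · intro h1 h2 x hx
      have hl0 : l = 0 := Prod.ext h1 h2
      -- The limit differs from the value at X by at most half of that value, so a zero limit makes
      -- the value zero.
      rw [hl0, zero_sub, norm_neg] at hl1
      have h3 : (bracket lam (-1) u f X, bracket lam 1 u f X) = 0 := by
        rw [← norm_le_zero_iff]
        linarith
      have h4 : bracket lam (-1) u f X = 0 := congrArg Prod.fst h3
      have h5 : bracket lam 1 u f X = 0 := congrArg Prod.snd h3
      have h6 := bracket_mul_sub lam u f X
      rw [h4, h5] at h6
      have hu : u X = 0 := by simpa [(hX X le_rfl).2.2.2.2.2.1] using h6.symm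
      have hf : f X = 0 := by
        rw [bracket, hu] at h4
        simpa [mode_ne_zero (-1) hX0 (hX X le_rfl).2.1] using h4
      exact h.eq_zero hR hXR hu hf hx
  · intro Y N hY hN
    obtain ⟨-, hP, hf0, hr₁, hr₂, hW, -⟩ := hX Y hY
    have hY0 := hX0.trans_le hY
    have hNY := hN Y (right_mem_Icc.2 hY)
    have ha := (norm_fst_le _).trans hNY
    have hb := (norm_snd_le _).trans hNY
    simp only at ha hb
    have hN0 : 0 ≤ N := (norm_nonneg _).trans hNY
    have hE := norm_modeRatio_of_im_eq_zero (him Y)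
    have hE0 := modeRatio_ne_zero lam Y
    have hI := Complex.I_ne_zero
    have hp0 : (fluxCoeff Y : ℂ) ≠ 0 := by exact_mod_cast (fluxCoeff_pos hY0).ne'
    have hz := mode_ne_zero (-1) hY0 hP
    have hrec := bracket_mul_sub lam u f Y
    rw [mode_one_eq, ← modeRatio, ← fluxCoeff_mul_mode_sq] at hrec
    have e0 : u Y = (bracket lam (-1) u f Y * modeRatio lam Y - bracket lam 1 u f Y) /
        (fluxCoeff Y * mode lam (-1) Y * (2 * Complex.I * freq lam Y * modeRatio lam Y)) := by
      rw [eq_div_iff (mul_ne_zero (mul_ne_zero hp0 hz) (mul_ne_zero (mul_ne_zero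
        (mul_ne_zero two_ne_zero hI) hf0) hE0))]
      apply mul_right_cancel₀ hz
      linear_combination -hrec
    have e1 : (fluxCoeff Y : ℂ) * residual lam (-1) Y * mode lam (-1) Y * u Y =
        residual lam (-1) Y * (freq lam Y)⁻¹ *
          ((bracket lam (-1) u f Y - bracket lam 1 u f Y / modeRatio lam Y) /
            (2 * Complex.I)) := by
      rw [e0]
      field_simp
    have e2 : (fluxCoeff Y : ℂ) * residual lam 1 Y * mode lam 1 Y * u Y =
        residual lam 1 Y * (freq lam Y)⁻¹ *
          ((bracket lam (-1) u f Y * modeRatio lam Y - bracket lam 1 u f Y) /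
            (2 * Complex.I)) := by
      rw [e0, mode_one_eq, ← modeRatio]
      field_simp
    have n2I : ‖(2 : ℂ) * Complex.I‖ = 2 := by simp
    rw [show (-(7 / 2) - 1 : ℝ) = -(9 / 2) by norm_num]
    have hs := Real.rpow_pos_of_pos hY0 (-(9 / 2))
    rw [Prod.norm_mk, max_le_iff, norm_neg, norm_neg, e1, e2,
      norm_mul _ (_ / _), norm_mul _ (_ / _), norm_div, norm_div, n2I]
    constructor
    · have h1 : ‖bracket lam (-1) u f Y - bracket lam 1 u f Y / modeRatio lam Y‖ ≤ 2 * N := by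
        refine (norm_sub_le _ _).trans ?_
        rw [norm_div, hE, div_one]
        linarith
      calc _ ≤ (C₁ * Y ^ (-(9 / 2) : ℝ)) * ((2 * N) / 2) := by gcongr
        _ ≤ (max C₁ C₂ * Y ^ (-(9 / 2) : ℝ)) * ((2 * N) / 2) := by
          gcongr
          exact le_max_left _ _
        _ = _ := by ring
    · have h1 : ‖bracket lam (-1) u f Y * modeRatio lam Y - bracket lam 1 u f Y‖ ≤ 2 * N := by
        refine (norm_sub_le _ _).trans ?_
        rw [norm_mul, hE, mul_one]
        linarith
      calc _ ≤ (C₂ * Y ^ (-(9 / 2) : ℝ)) * ((2 * N) / 2) := by gcongr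
        _ ≤ (max C₁ C₂ * Y ^ (-(9 / 2) : ℝ)) * ((2 * N) / 2) := by
          gcongr
          exact le_max_right _ _
        _ = _ := by ring

/-- Sending initial data at 1 to the pair of bracket limits is a linear map of ℂ × ℂ into itself. It
is injective because zero limits force the zero solution, hence surjective by dimension. -/
theorem exists_of_bracket_limit {lam : ℂ} (hlam : lam ≠ 0) (him : ∀ x, (phase lam x).im = 0)
    (L : ℂ × ℂ) : ∃ u f : ℝ → ℂ, IsSystemSolution lam 0 u f ∧
      HasRateLimit (bracket lam (-1) u f) L.1 ∧ HasRateLimit (bracket lam 1 u f) L.2 := by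
  obtain ⟨u₁, f₁, h₁, hu₁, hf₁⟩ := exists_isSystemSolution lam one_pos 1 0
  obtain ⟨u₂, f₂, h₂, hu₂, hf₂⟩ := exists_isSystemSolution lam one_pos 0 1
  obtain ⟨a₁, b₁, ha₁, hb₁, -⟩ := exists_bracket_limit hlam him le_rfl h₁
  obtain ⟨a₂, b₂, ha₂, hb₂, -⟩ := exists_bracket_limit hlam him le_rfl h₂
  have hcomb : ∀ (c₁ c₂ σ p q : ℂ), HasRateLimit (bracket lam σ u₁ f₁) p →
      HasRateLimit (bracket lam σ u₂ f₂) q →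
      HasRateLimit (bracket lam σ (fun x => c₁ * u₁ x + c₂ * u₂ x)
        (fun x => c₁ * f₁ x + c₂ * f₂ x)) (c₁ * p + c₂ * q) := by
    intro c₁ c₂ σ p q hp hq
    refine ((IsBigO.const_mul_left hp c₁).add (IsBigO.const_mul_left hq c₂)).congr_left
      fun x => ?_
    rw [bracket_linearCombination]
    ring
  let Λ : (ℂ × ℂ) →ₗ[ℂ] (ℂ × ℂ) :=
    (LinearMap.fst ℂ ℂ ℂ).smulRight (a₁, b₁) + (LinearMap.snd ℂ ℂ ℂ).smulRight (a₂, b₂)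
  have hΛ : ∀ c, Λ c = (c.1 * a₁ + c.2 * a₂, c.1 * b₁ + c.2 * b₂) := by
    intro c
    simp [Λ]
  have hinj : Function.Injective Λ := by
    rw [injective_iff_map_eq_zero]
    intro c hc
    rw [hΛ] at hc
    have h := h₁.linearCombination h₂ c.1 c.2
    obtain ⟨la, lb, hla, hlb, h0⟩ := exists_bracket_limit hlam him le_rfl h
    have e1 := tendsto_nhds_unique hla.tendsto (hcomb c.1 c.2 _ _ _ ha₁ ha₂).tendsto
    have e2 := tendsto_nhds_unique hlb.tendsto (hcomb c.1 c.2 _ _ _ hb₁ hb₂).tendsto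
    have h3 := h0 (e1.trans (congrArg Prod.fst hc)) (e2.trans (congrArg Prod.snd hc)) 1 one_pos
    simp only [hu₁, hf₁, hu₂, hf₂, mul_one, mul_zero, add_zero, zero_add] at h3
    exact Prod.ext h3.1 h3.2
  obtain ⟨c, hc⟩ := (LinearMap.injective_iff_surjective.1 hinj) L
  rw [hΛ] at hc
  refine ⟨_, _, h₁.linearCombination h₂ c.1 c.2, ?_, ?_⟩
  · have := hcomb c.1 c.2 _ _ _ ha₁ ha₂
    rwa [show c.1 * a₁ + c.2 * a₂ = L.1 from congrArg Prod.fst hc] at this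
  · have := hcomb c.1 c.2 _ _ _ hb₁ hb₂
    rwa [show c.1 * b₁ + c.2 * b₂ = L.2 from congrArg Prod.snd hc] at this

/-- Used for the unwanted mode: its coefficient tends to 0, while the factor z₊/z₋ oscillates
without a limit. -/
theorem HasRateLimit.mul_of_norm_le_one {f g : ℝ → ℂ} (hf : HasRateLimit f 0)
    (hg : ∀ x, ‖g x‖ ≤ 1) : HasRateLimit (fun x => f x * g x) 0 := by
  have h1 : g =O[atTop] fun _ : ℝ => (1 : ℝ) :=
    IsBigO.of_bound 1 (Eventually.of_forall fun x => by simpa using hg x)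
  have h2 := IsBigO.mul hf h1
  simp only [mul_one, sub_zero] at h2
  simpa [HasRateLimit] using h2

theorem HasRateLimit.add {f g : ℝ → ℂ} {a b : ℂ} (hf : HasRateLimit f a)
    (hg : HasRateLimit g b) : HasRateLimit (fun x => f x + g x) (a + b) := by
  refine (IsBigO.add hf hg).congr_left fun x => ?_
  ring

theorem exists_modes_of_phase_im_eq_zero {lam : ℂ} (hlam : lam ≠ 0)
    (him : ∀ x, (phase lam x).im = 0) :
    ∃ u f v g : ℝ → ℂ, IsSystemSolution lam 0 u f ∧ IsSystemSolution lam 0 v g ∧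
      HasModeForm lam 1 u ∧ HasModeForm lam (-1) v := by
  set k := 5 / 2 * Complex.I * root lam with hk
  have hk0 : k ≠ 0 := wronskianLimit_ne_zero hlam
  -- By `bracket_mul_sub` the coefficients of z₊ and z₋ are the first bracket and minus the second,
  -- divided by the Wronskian. The pairs (k, 0) and (0, -k) therefore single out one mode each.
  obtain ⟨u, f, h, ha, hb⟩ := exists_of_bracket_limit hlam him (k, 0)
  obtain ⟨v, g, h', ha', hb'⟩ := exists_of_bracket_limit hlam him (0, -k)
  have hΩ : HasRateLimit (fun x => (modeWronskian lam x)⁻¹) k⁻¹ :=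
    (hasRateLimit_modeWronskian lam).inv hk0
  have hE : ∀ x, ‖modeRatio lam x‖ = 1 := fun x => norm_modeRatio_of_im_eq_zero (him x)
  have hW0 := (tendsto_modeWronskian lam).eventually_ne hk0
  refine ⟨u, f, v, g, h, h',
    HasRateLimit.hasModeForm ?_, HasRateLimit.hasModeForm ?_⟩
  · have h1 := ha.mul hΩ
    have h2 := (hb.mul hΩ).const_mul (-1)
    simp only [zero_mul, mul_zero] at h2
    have h3 := h1.add (h2.mul_of_norm_le_one (g := fun x => (modeRatio lam x)⁻¹)
      (fun x => by rw [norm_inv, hE, inv_one]))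
    simp only [mul_inv_cancel₀ hk0, add_zero] at h3
    refine h3.congr ?_
    filter_upwards [hW0, eventually_gt_atTop 0, eventually_ampPoly_ne_zero lam⁻¹]
      with x hW hx hP
    have hz := mode_ne_zero (-1) hx hP
    have hr := modeRatio_ne_zero lam x
    have hrec := bracket_mul_sub lam u f x
    rw [mode_one_eq, ← modeRatio] at hrec ⊢
    field_simp
    linear_combination hrec
  · have h1 := hb'.mul hΩ |>.const_mul (-1)
    have h2 := (ha'.mul hΩ)
    simp only [zero_mul] at h2
    have h3 := h1.add (h2.mul_of_norm_le_one (g := fun x => modeRatio lam x)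
      (fun x => (hE x).le))
    rw [show -1 * (-k * k⁻¹) + 0 = 1 by field_simp; ring] at h3
    refine h3.congr ?_
    filter_upwards [hW0, eventually_gt_atTop 0, eventually_ampPoly_ne_zero lam⁻¹]
      with x hW hx hP
    have hz := mode_ne_zero (-1) hx hP
    have hrec := bracket_mul_sub lam v g x
    rw [mode_one_eq, ← modeRatio] at hrec
    field_simp
    linear_combination hrec

/-! ### Oscillation -/

/-- By the intermediate value theorem φ takes the value 2πn - arg κ arbitrarily far out. There the
real part equals ‖κ‖, which must then be 0. -/
theorem eq_zero_of_tendsto_re {φ : ℝ → ℝ} (hc : ContinuousOn φ (Ioi 0))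
    (ht : Tendsto φ atTop atTop) {κ : ℂ}
    (h : Tendsto (fun x => (κ * Complex.exp (Complex.I * φ x)).re) atTop (𝓝 0)) : κ = 0 := by
  by_contra hκ
  have hpos := norm_pos_iff.2 hκ
  obtain ⟨X₀, hX₀⟩ := eventually_atTop.1 (h.eventually (gt_mem_nhds hpos))
  set X := max X₀ 1
  have hX1 : 1 ≤ X := le_max_right _ _
  obtain ⟨n, hn⟩ := exists_nat_ge ((φ X + κ.arg) / (2 * Real.pi))
  rw [div_le_iff₀ Real.two_pi_pos] at hn
  obtain ⟨Y, hY1, hY2⟩ := ((ht.eventually_ge_atTop (n * (2 * Real.pi) - κ.arg)).and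
    (eventually_ge_atTop X)).exists
  have hsub : Icc X Y ⊆ Ioi 0 := fun x hx => one_pos.trans_le (hX1.trans hx.1)
  obtain ⟨x, hx, hφ⟩ := intermediate_value_Icc hY2 (hc.mono hsub)
    (show (n * (2 * Real.pi) - κ.arg) ∈ Icc (φ X) (φ Y) from ⟨by linarith, hY1⟩)
  have h1 := hX₀ x ((le_max_left _ _).trans hx.1)
  have h2 : κ * Complex.exp (Complex.I * φ x) = ‖κ‖ := by
    nth_rewrite 1 [← Complex.norm_mul_exp_arg_mul_I κ]
    rw [mul_assoc, ← Complex.exp_add, hφ]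
    have : (κ.arg : ℂ) * Complex.I + Complex.I * ((n * (2 * Real.pi) - κ.arg : ℝ) : ℂ) =
        n * (2 * Real.pi * Complex.I) := by
      push_cast
      ring
    rw [this, Complex.exp_nat_mul_two_pi_mul_I, mul_one]
  simp only [h2, Complex.ofReal_re, lt_self_iff_false] at h1

theorem conj_exp_I_mul (t : ℝ) :
    conj (Complex.exp (Complex.I * t)) = Complex.exp (-(Complex.I * t)) := by
  rw [← Complex.exp_conj]
  simp

theorem re_mul_exp_add (α β : ℂ) (t : ℝ) :
    (α * Complex.exp (Complex.I * t) + β * Complex.exp (-(Complex.I * t))).re =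
      ((α + conj β) * Complex.exp (Complex.I * t)).re := by
  rw [← conj_exp_I_mul]
  simp [Complex.mul_re, Complex.add_re, Complex.add_im]
  ring

theorem im_mul_exp_add (α β : ℂ) (t : ℝ) :
    (α * Complex.exp (Complex.I * t) + β * Complex.exp (-(Complex.I * t))).im =
      ((-Complex.I * (α - conj β)) * Complex.exp (Complex.I * t)).re := by
  rw [← conj_exp_I_mul]
  simp [Complex.mul_re, Complex.mul_im, Complex.add_im]
  ring

theorem eq_conj_of_tendsto_im {φ : ℝ → ℝ} (hc : ContinuousOn φ (Ioi 0))
    (ht : Tendsto φ atTop atTop) {α β : ℂ}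
    (h : Tendsto (fun x => (α * Complex.exp (Complex.I * φ x) +
      β * Complex.exp (-(Complex.I * φ x))).im) atTop (𝓝 0)) : α = conj β := by
  simp only [im_mul_exp_add] at h
  have := eq_zero_of_tendsto_re hc ht h
  rw [mul_eq_zero] at this
  rcases this with h | h
  · simp at h
  · exact sub_eq_zero.1 h

theorem eq_neg_conj_of_tendsto_re {φ : ℝ → ℝ} (hc : ContinuousOn φ (Ioi 0))
    (ht : Tendsto φ atTop atTop) {α β : ℂ}
    (h : Tendsto (fun x => (α * Complex.exp (Complex.I * φ x) +
      β * Complex.exp (-(Complex.I * φ x))).re) atTop (𝓝 0)) : α = -conj β := by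
  simp only [re_mul_exp_add] at h
  exact eq_neg_of_add_eq_zero_left (eq_zero_of_tendsto_re hc ht h)

/-! ### Positive real parameters -/

/-- The phase for a positive real parameter. -/
noncomputable def realPhase (lam x : ℝ) : ℝ :=
  Real.sqrt (8 * lam / 25) * P1 lam x * x ^ (5 / 2 : ℝ)

theorem root_ofReal {lam : ℝ} (hlam : 0 < lam) :
    root (lam : ℂ) = (Real.sqrt (8 * lam / 25) : ℂ) := by
  have h : (8 * (lam : ℂ) / 25) = ((8 * lam / 25 : ℝ) : ℂ) := by push_cast; ring
  rw [root, h, Complex.sqrt_of_nonneg (by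
    rw [Complex.zero_le_real]
    positivity), Complex.ofReal_re]

theorem phase_ofReal {lam : ℝ} (hlam : 0 < lam) (x : ℝ) :
    phase (lam : ℂ) x = (realPhase lam x : ℂ) := by
  rw [phase, realPhase, root_ofReal hlam]
  simp [P1]

theorem phase_im_ofReal {lam : ℝ} (hlam : 0 < lam) (x : ℝ) : (phase (lam : ℂ) x).im = 0 := by
  rw [phase_ofReal hlam, Complex.ofReal_im]

theorem continuousOn_realPhase {lam : ℝ} (hlam : 0 < lam) :
    ContinuousOn (realPhase lam) (Ioi 0) := by
  intro x hx
  have hl : (lam : ℂ) ≠ 0 := by exact_mod_cast hlam.ne'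
  have h := Complex.continuous_re.continuousAt.comp (hasDerivAt_phase hl hx).continuousAt
  refine (h.congr (Eventually.of_forall fun y => ?_)).continuousWithinAt
  simp [phase_ofReal hlam]

theorem tendsto_realPhase {lam : ℝ} (hlam : 0 < lam) :
    Tendsto (realPhase lam) atTop atTop := by
  have hl : (lam : ℂ) ≠ 0 := by exact_mod_cast hlam.ne'
  refine (tendsto_phase_re hl ?_).congr fun x => by rw [phase_ofReal hlam, Complex.ofReal_re]
  rw [root_ofReal hlam, Complex.ofReal_re]
  positivity

theorem P0_ofReal (lam x : ℝ) : P0 (lam : ℂ) (x : ℂ) = ((P0 lam x : ℝ) : ℂ) := by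
  simp [P0]

theorem mode_ofReal {lam : ℝ} (hlam : 0 < lam) (σ : ℂ) (x : ℝ) : mode (lam : ℂ) σ x =
    ((x ^ (-(1 / 4) : ℝ) * Real.exp (x ^ 2 / 2) * P0 lam x : ℝ) : ℂ) *
      Complex.exp (σ * (Complex.I * realPhase lam x)) := by
  rw [mode_eq, phase_ofReal hlam, P0_ofReal]
  push_cast
  ring_nf

/-! ### Linear independence -/

/-- Dividing the relation by z₋ and letting x tend to infinity kills the first term and gives c₂ =
0. The remaining mode does not vanish. -/
theorem coeff_eq_zero_of_im_pos {lam : ℂ} (hlam : lam ≠ 0) (hr : 0 < (root lam).im)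
    {u v : ℝ → ℂ} (hu : HasModeForm lam 1 u) (hv : HasModeForm lam (-1) v) {c₁ c₂ : ℂ}
    (h : ∀ᶠ x in atTop, c₁ * u x + c₂ * v x = 0) : c₁ = 0 ∧ c₂ = 0 := by
  obtain ⟨ε, hε, hu⟩ := hu
  obtain ⟨δ, hδ, hv⟩ := hv
  have hε0 := hε.trans_tendsto (tendsto_rpow_neg_atTop (by norm_num))
  have hδ0 := hδ.trans_tendsto (tendsto_rpow_neg_atTop (by norm_num))
  have hE : Tendsto (modeRatio lam) atTop (𝓝 0) := by
    rw [tendsto_zero_iff_norm_tendsto_zero]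
    simp only [norm_modeRatio]
    exact Real.tendsto_exp_atBot.comp
      ((tendsto_phase_im hlam hr).const_mul_atTop_of_neg (by norm_num))
  have hrel : ∀ᶠ x in atTop, c₁ * (modeRatio lam x * (1 + ε x)) + c₂ * (1 + δ x) = 0 := by
    filter_upwards [h, hu, hv, eventually_gt_atTop 0, eventually_ampPoly_ne_zero lam⁻¹]
      with x h1 h2 h3 hx hP
    rw [h2, h3, mode_one_eq, ← modeRatio] at h1
    apply mul_right_cancel₀ (mode_ne_zero (-1) hx hP)
    linear_combination h1
  have hlim : Tendsto (fun x => c₁ * (modeRatio lam x * (1 + ε x)) + c₂ * (1 + δ x)) atTop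
      (𝓝 (c₁ * (0 * (1 + 0)) + c₂ * (1 + 0))) :=
    ((hE.mul (hε0.const_add 1)).const_mul c₁).add ((hδ0.const_add 1).const_mul c₂)
  have h0 := tendsto_nhds_unique hlim (tendsto_const_nhds.congr' (hrel.mono fun x hx => hx.symm))
  have hc₂ : c₂ = 0 := by simpa using h0
  refine ⟨?_, hc₂⟩
  have hne : (1 : ℂ) + 0 ≠ 0 := by simp
  obtain ⟨x, hx1, hx2⟩ := (hrel.and ((hε0.const_add 1).eventually_ne hne)).exists
  simpa [hc₂, modeRatio_ne_zero, hx2] using hx1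

/-- After division by the common real amplitude, c₁ e^(iφ) + c₂ e^(-iφ) tends to 0. Its real and
imaginary parts give c₁ = -conj c₂ and c₁ = conj c₂. -/
theorem coeff_eq_zero_of_pos {lam : ℝ} (hlam : 0 < lam)
    {u v : ℝ → ℂ} (hu : HasModeForm lam 1 u) (hv : HasModeForm lam (-1) v) {c₁ c₂ : ℂ}
    (h : ∀ᶠ x in atTop, c₁ * u x + c₂ * v x = 0) : c₁ = 0 ∧ c₂ = 0 := by
  obtain ⟨ε, hε, hu⟩ := hu
  obtain ⟨δ, hδ, hv⟩ := hv
  have hε0 := hε.trans_tendsto (tendsto_rpow_neg_atTop (by norm_num))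
  have hδ0 := hδ.trans_tendsto (tendsto_rpow_neg_atTop (by norm_num))
  have hn : ∀ x : ℝ, ‖Complex.exp (Complex.I * realPhase lam x)‖ ≤ 1 := fun x => by
    rw [mul_comm, Complex.norm_exp_ofReal_mul_I]
  have hn' : ∀ x : ℝ, ‖Complex.exp (-(Complex.I * realPhase lam x))‖ ≤ 1 := fun x => by
    rw [← conj_exp_I_mul, Complex.norm_conj]
    exact hn x
  have hsmall : Tendsto (fun x => -(c₁ * (ε x * Complex.exp (Complex.I * realPhase lam x)) +
      c₂ * (δ x * Complex.exp (-(Complex.I * realPhase lam x))))) atTop (𝓝 0) := by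
    have h1 := hε0.zero_mul_isBoundedUnder_le (g := fun x : ℝ =>
      Complex.exp (Complex.I * realPhase lam x)) (isBoundedUnder_of ⟨1, hn⟩)
    have h2 := hδ0.zero_mul_isBoundedUnder_le (g := fun x : ℝ =>
      Complex.exp (-(Complex.I * realPhase lam x))) (isBoundedUnder_of ⟨1, hn'⟩)
    simpa using ((h1.const_mul c₁).add (h2.const_mul c₂)).neg
  have hmain : Tendsto (fun x => c₁ * Complex.exp (Complex.I * realPhase lam x) +
      c₂ * Complex.exp (-(Complex.I * realPhase lam x))) atTop (𝓝 0) := by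
    refine hsmall.congr' ?_
    filter_upwards [h, hu, hv, eventually_gt_atTop 0, eventually_ampPoly_ne_zero (lam : ℂ)⁻¹]
      with x h1 h2 h3 hx hP
    -- Taking σ = 0 trivializes the oscillating factor; what is wanted is only that the amplitude is
    -- nonzero.
    have hz := mode_ne_zero 0 hx hP
    rw [mode_ofReal hlam] at hz
    have hA := left_ne_zero_of_mul hz
    rw [h2, h3, mode_ofReal hlam, mode_ofReal hlam, one_mul, neg_one_mul] at h1
    apply mul_left_cancel₀ hA
    linear_combination -h1
  have hre := eq_neg_conj_of_tendsto_re (continuousOn_realPhase hlam) (tendsto_realPhase hlam)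
    ((Complex.continuous_re.tendsto 0).comp hmain)
  have him := eq_conj_of_tendsto_im (continuousOn_realPhase hlam) (tendsto_realPhase hlam)
    ((Complex.continuous_im.tendsto 0).comp hmain)
  have h1 : c₁ = 0 := by
    have : (2 : ℂ) * c₁ = 0 := by linear_combination hre + him
    simpa using this
  refine ⟨h1, ?_⟩
  rw [h1] at him
  simpa using him.symm

/-! ### Conjugation -/

theorem IsSystemSolution.conj {lam : ℂ} {R : ℝ} {u f : ℝ → ℂ}
    (h : IsSystemSolution lam R u f) :
    IsSystemSolution (conj lam) R (fun x => conj (u x)) (fun x => conj (f x)) := by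
  intro x hx
  have hd : ∀ {w : ℝ → ℂ} {w' : ℂ}, HasDerivAt w w' x →
      HasDerivAt (fun x => (starRingEnd ℂ) (w x)) ((starRingEnd ℂ) w') x := fun hw =>
    (Complex.conjCLE.toContinuousLinearMap.hasFDerivAt.comp_hasDerivAt x hw)
  refine ⟨(hd (h x hx).1).congr_deriv ?_, (hd (h x hx).2).congr_deriv ?_⟩ <;> simp

/-- The principal root commutes with conjugation off the negative axis. On that axis its imaginary
part is nonnegative, which the hypothesis excludes. -/
theorem root_conj {lam : ℂ} (hr : (root lam).im < 0) : root (conj lam) = conj (root lam) := by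
  have harg : (8 * lam / 25).arg ≠ Real.pi := by
    intro h
    have him := (Complex.arg_eq_pi_iff.1 h).2
    rw [root, Complex.sqrt, Complex.cpow_inv_two_im_eq_sqrt him.ge] at hr
    exact absurd hr (not_lt.2 (Real.sqrt_nonneg _))
  have h := Complex.conj_cpow (8 * lam / 25) (2⁻¹ : ℂ) harg
  rw [root, root, Complex.sqrt, Complex.sqrt]
  simpa [map_div₀, map_mul, map_ofNat] using h

/-- Conjugation turns i into -i, so the two modes trade places when λ is conjugated. -/
theorem mode_conj {lam : ℂ} (hr : (root lam).im < 0) {σ : ℂ} (hσ : conj σ = σ) (x : ℝ) :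
    mode lam σ x = conj (mode (conj lam) (-σ) x) := by
  have hP1 : P1 (conj lam) (x : ℂ) = conj (P1 lam (x : ℂ)) := by simp [P1, map_ofNat]
  have hP0 : P0 (conj lam) (x : ℂ) = conj (P0 lam (x : ℂ)) := by simp [P0, map_ofNat]
  have hphase : phase (conj lam) x = conj (phase lam x) := by
    rw [phase, phase, root_conj hr, hP1]
    simp
  rw [mode_eq, mode_eq, hphase, hP0, map_mul, map_mul, ← Complex.exp_conj,
    Complex.conj_ofReal]
  simp [hσ]

theorem HasModeForm.conj {lam : ℂ} (hr : (root lam).im < 0) {σ : ℂ} (hσ : conj σ = σ)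
    {u : ℝ → ℂ} (h : HasModeForm (conj lam) (-σ) u) : HasModeForm lam σ fun x => conj (u x) := by
  obtain ⟨ε, hε, hu⟩ := h
  refine ⟨fun x => (starRingEnd ℂ) (ε x),
    (IsBigO.of_bound 1 (Eventually.of_forall fun x => by simp)).trans hε, ?_⟩
  filter_upwards [hu] with x hx
  rw [hx, mode_conj hr hσ]
  simp

/-! ### The main theorem -/

theorem exists_modes {lam : ℂ} (hlam : lam ≠ 0) :
    ∃ u f v g : ℝ → ℂ, IsSystemSolution lam 0 u f ∧ IsSystemSolution lam 0 v g ∧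
      HasModeForm lam 1 u ∧ HasModeForm lam (-1) v ∧
      ∀ c₁ c₂ : ℂ, (∀ᶠ x in atTop, c₁ * u x + c₂ * v x = 0) → c₁ = 0 ∧ c₂ = 0 := by
  rcases lt_trichotomy (root lam).im 0 with hr | hr | hr
  · have hr' : 0 < (root (conj lam)).im := by
      rw [root_conj hr, Complex.conj_im]
      linarith
    have hlam' : conj lam ≠ 0 := by simpa using hlam
    obtain ⟨u, f, v, g, hu, hv, hmu, hmv⟩ := exists_modes_of_im_pos hlam' hr'
    have hu' := hu.conj
    have hv' := hv.conj
    rw [Complex.conj_conj] at hu' hv'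
    refine ⟨_, _, _, _, hv', hu', hmv.conj hr (by simp), HasModeForm.conj hr (by simp)
      (by simpa using hmu), fun c₁ c₂ h => ?_⟩
    have h2 := coeff_eq_zero_of_im_pos hlam' hr' hmu hmv (c₁ := conj c₂) (c₂ := conj c₁)
      (h.mono fun x hx => by
        have := congrArg (starRingEnd ℂ) hx
        simp only [map_add, map_mul, Complex.conj_conj, map_zero] at this
        rw [add_comm]
        exact this)
    simpa [and_comm] using h2
  -- A real nonzero root has positive square 8λ/25, so this is exactly the case of positive λ.
  · have hroot : root lam = ((root lam).re : ℂ) := Complex.ext (by simp) (by simpa using hr)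
    have hre : (root lam).re ≠ 0 := fun h => root_ne_zero hlam (by rw [hroot, h]; simp)
    have hl : lam = ((25 / 8 * (root lam).re ^ 2 : ℝ) : ℂ) := by
      have := root_sq lam
      rw [hroot] at this
      push_cast
      linear_combination (-25 / 8) * this
    have hpos : 0 < 25 / 8 * (root lam).re ^ 2 := by positivity
    generalize 25 / 8 * (root lam).re ^ 2 = r at hl hpos
    subst hl
    obtain ⟨u, f, v, g, hu, hv, hmu, hmv⟩ :=
      exists_modes_of_phase_im_eq_zero hlam (phase_im_ofReal hpos)
    exact ⟨u, f, v, g, hu, hv, hmu, hmv, fun c₁ c₂ h => coeff_eq_zero_of_pos hpos hmu hmv h⟩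
  · obtain ⟨u, f, v, g, hu, hv, hmu, hmv⟩ := exists_modes_of_im_pos hlam hr
    exact ⟨u, f, v, g, hu, hv, hmu, hmv, fun c₁ c₂ h => coeff_eq_zero_of_im_pos hlam hr hmu hmv h⟩

/-! ### Cosine asymptotics of real solutions -/

theorem tendsto_P0_ofReal (lam : ℝ) : Tendsto (fun x : ℝ => P0 lam x) atTop (𝓝 1) := by
  have h := (Complex.continuous_re.tendsto _).comp (tendsto_ampPoly (lam : ℂ)⁻¹)
  refine h.congr fun x => ?_
  rw [Function.comp_apply, ← P0_eq_ampPoly, P0_ofReal, Complex.ofReal_re]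

theorem yVar_amplitude {lam x : ℝ} (hx : 0 < x) (c : ℝ) :
    x * Real.exp (-x ^ 2 / 2) *
      (x ^ (-(1 / 4) : ℝ) * Real.exp (x ^ 2 / 2) * P0 lam x * c) =
      x ^ (3 / 4 : ℝ) * P0 lam x * c := by
  have h1 : x * x ^ (-(1 / 4) : ℝ) = x ^ (3 / 4 : ℝ) := by
    rw [mul_comm, ← Real.rpow_add_one hx.ne']
    norm_num
  have h2 : Real.exp (-x ^ 2 / 2) * Real.exp (x ^ 2 / 2) = 1 := by
    rw [← Real.exp_add]
    ring_nf
    simp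
  calc _ = (x * x ^ (-(1 / 4) : ℝ)) * (Real.exp (-x ^ 2 / 2) * Real.exp (x ^ 2 / 2)) *
        P0 lam x * c := by ring
    _ = _ := by rw [h1, h2, mul_one]

theorem rpow_mul_P0_isBigO (lam : ℝ) {g : ℝ → ℝ}
    (hg : g =O[atTop] fun x : ℝ => x ^ (-(7 / 2) : ℝ)) :
    (fun x => x ^ (3 / 4 : ℝ) * P0 lam x * g x) =O[atTop] fun x : ℝ => x ^ (-(11 / 4) : ℝ) := by
  have h := ((isBigO_refl (fun x : ℝ => x ^ (3 / 4 : ℝ)) atTop).mul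
    ((tendsto_P0_ofReal lam).isBigO_one ℝ)).mul hg
  refine h.trans_eventuallyEq ?_
  filter_upwards [eventually_gt_atTop 0] with x hx
  rw [mul_one, ← Real.rpow_add hx]
  norm_num

/-- The difference of the two cosine terms, divided by the common amplitude, is the real part of κ
e^(iφ) with κ = C e^(-iθ) - C' e^(-iθ'). It tends to 0, so κ = 0. -/
theorem HasCosForm.unique {lam : ℝ} (hlam : 0 < lam) {y : ℝ → ℝ} {C θ C' θ' : ℝ}
    (h : HasCosForm lam C θ y) (h' : HasCosForm lam C' θ' y) :
    C' * Real.cos θ' = C * Real.cos θ ∧ C' * Real.sin θ' = C * Real.sin θ := by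
  set κ : ℂ := C * Complex.exp (-(Complex.I * θ)) - C' * Complex.exp (-(Complex.I * θ')) with hκ
  have hcos : ∀ (C θ t : ℝ), (C * Complex.exp (-(Complex.I * θ)) *
      Complex.exp (Complex.I * t)).re = C * Real.cos (t - θ) := by
    intro C θ t
    rw [mul_assoc, ← Complex.exp_add, Complex.re_ofReal_mul]
    congr 1
    rw [show -(Complex.I * (θ : ℂ)) + Complex.I * (t : ℂ) = ((t - θ : ℝ) : ℂ) * Complex.I by
      push_cast; ring, Complex.exp_ofReal_mul_I_re]
  have hκ0 : κ = 0 := by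
    refine eq_zero_of_tendsto_re (continuousOn_realPhase hlam) (tendsto_realPhase hlam) ?_
    have h1 := (IsBigO.sub h' h).mul (isBigO_refl (fun x : ℝ => x ^ (-(3 / 4) : ℝ)) atTop)
    have h2 := h1.mul (((tendsto_P0_ofReal lam).inv₀ one_ne_zero).isBigO_one ℝ)
    have h3 : Tendsto (fun x : ℝ => x ^ (-(11 / 4) : ℝ) * x ^ (-(3 / 4) : ℝ) * 1) atTop
        (𝓝 0) := by
      simpa using ((tendsto_rpow_neg_atTop (y := 11 / 4) (by norm_num)).mul
        (tendsto_rpow_neg_atTop (y := 3 / 4) (by norm_num)))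
    refine (h2.trans_tendsto h3).congr' ?_
    filter_upwards [eventually_gt_atTop 0, (tendsto_P0_ofReal lam).eventually_ne one_ne_zero]
      with x hx hP
    have hre : (κ * Complex.exp (Complex.I * realPhase lam x)).re =
        C * Real.cos (realPhase lam x - θ) - C' * Real.cos (realPhase lam x - θ') := by
      rw [hκ, sub_mul, Complex.sub_re, hcos, hcos]
    rw [hre, Real.rpow_neg hx.le, realPhase]
    have := (Real.rpow_pos_of_pos hx (3 / 4)).ne'
    field_simp
    ring
  have h1 : (C : ℂ) * Complex.exp (-(Complex.I * θ)) = C' * Complex.exp (-(Complex.I * θ')) :=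
    sub_eq_zero.1 hκ0
  have hexp : ∀ t : ℝ, Complex.exp (-(Complex.I * t)) =
      (Real.cos t : ℂ) - (Real.sin t : ℂ) * Complex.I := by
    intro t
    rw [← conj_exp_I_mul, mul_comm, Complex.exp_mul_I]
    simp [← Complex.cos_conj, ← Complex.sin_conj]
    ring
  rw [hexp, hexp] at h1
  have hre := congrArg Complex.re h1
  have him := congrArg Complex.im h1
  simp only [Complex.sub_re, Complex.sub_im,
    Complex.mul_re, Complex.mul_im, Complex.ofReal_re, Complex.ofReal_im, Complex.I_re,
    Complex.I_im] at hre him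
  constructor <;> linarith

theorem exists_hasCosForm {lam : ℝ} (hlam : 0 < lam) {R : ℝ} (hR : 0 ≤ R) {u : ℝ → ℝ}
    (hu : IsSolution lam R u) : ∃ C θ : ℝ, HasCosForm lam C θ (yVar u) ∧
      ((∃ x : ℝ, R < x ∧ u x ≠ 0) → C ≠ 0) := by
  have hl : (lam : ℂ) ≠ 0 := by exact_mod_cast hlam.ne'
  have hsys := isSystemSolution_of_isSolution_real hR hu
  obtain ⟨la, lb, ha, hb, h0⟩ := exists_bracket_limit hl (phase_im_ofReal hlam) hR hsys
  set U : ℝ → ℂ := fun x => (u x : ℂ)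
  set F : ℝ → ℂ := fun x => ((fluxCoeff x * deriv u x : ℝ) : ℂ)
  set k := 5 / 2 * Complex.I * root lam with hk
  have hk0 : k ≠ 0 := wronskianLimit_ne_zero hl
  have hΩ := hasRateLimit_modeWronskian (lam : ℂ)
  have ha' : HasRateLimit (fun x => bracket lam (-1) U F x / modeWronskian lam x) (la / k) :=
    ha.div hΩ hk0
  have hb' : HasRateLimit (fun x => -1 * (bracket lam 1 U F x / modeWronskian lam x))
      (-1 * (lb / k)) := (hb.div hΩ hk0).const_mul _
  set α := la / k
  set β := -1 * (lb / k) with hβ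
  set G : ℝ → ℂ := fun x => bracket lam (-1) U F x / modeWronskian lam x *
      Complex.exp (Complex.I * realPhase lam x) +
    -1 * (bracket lam 1 U F x / modeWronskian lam x) *
      Complex.exp (-(Complex.I * realPhase lam x)) with hG
  set G₀ : ℝ → ℂ := fun x => α * Complex.exp (Complex.I * realPhase lam x) +
      β * Complex.exp (-(Complex.I * realPhase lam x)) with hG₀
  have hn : (fun x : ℝ => Complex.exp (Complex.I * realPhase lam x)) =O[atTop]
      fun _ : ℝ => (1 : ℝ) := IsBigO.of_bound 1 (Eventually.of_forall fun x => by
    rw [mul_comm Complex.I, Complex.norm_exp_ofReal_mul_I]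
    simp)
  have hn' : (fun x : ℝ => Complex.exp (-(Complex.I * realPhase lam x))) =O[atTop]
      fun _ : ℝ => (1 : ℝ) := IsBigO.of_bound 1 (Eventually.of_forall fun x => by
    rw [← conj_exp_I_mul, Complex.norm_conj, mul_comm Complex.I, Complex.norm_exp_ofReal_mul_I]
    simp)
  have hdiff : (fun x => G x - G₀ x) =O[atTop] fun x : ℝ => x ^ (-(7 / 2) : ℝ) := by
    have h1 := (IsBigO.mul ha' hn).add (IsBigO.mul hb' hn')
    simp only [mul_one] at h1
    refine h1.congr_left fun x => ?_
    simp only [hG, hG₀]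
    ring
  have hUG : ∀ᶠ x : ℝ in atTop, U x =
      ((x ^ (-(1 / 4) : ℝ) * Real.exp (x ^ 2 / 2) * P0 lam x : ℝ) : ℂ) * G x := by
    filter_upwards [(tendsto_modeWronskian (lam : ℂ)).eventually_ne hk0] with x hW
    have hrec := bracket_mul_sub (lam : ℂ) U F x
    rw [mode_ofReal hlam, mode_ofReal hlam, one_mul, neg_one_mul] at hrec
    simp only [hG]
    field_simp
    linear_combination -hrec
  have hamp : ∀ᶠ x : ℝ in atTop,
      x ^ (-(1 / 4) : ℝ) * Real.exp (x ^ 2 / 2) * P0 lam x ≠ 0 := by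
    filter_upwards [eventually_gt_atTop 0, (tendsto_P0_ofReal lam).eventually_ne one_ne_zero]
      with x hx hP
    have := Real.rpow_pos_of_pos hx (-(1 / 4))
    exact mul_ne_zero (by positivity) hP
  have hlim := hdiff.trans_tendsto (tendsto_rpow_neg_atTop (by norm_num))
  -- The exact coefficient function G is real because the solution and its amplitude are. Hence the
  -- imaginary part of the limiting oscillation G₀ tends to 0.
  have hαβ : α = conj β := by
    refine eq_conj_of_tendsto_im (continuousOn_realPhase hlam) (tendsto_realPhase hlam) ?_
    have h1 : Tendsto (fun x => -(G x - G₀ x).im) atTop (𝓝 (-0)) :=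
      ((Complex.continuous_im.tendsto 0).comp hlim).neg
    rw [neg_zero] at h1
    refine h1.congr' ?_
    filter_upwards [hUG, hamp] with x hx hA
    have h2 := congrArg Complex.im hx
    rw [Complex.im_ofReal_mul, Complex.ofReal_im, eq_comm, mul_eq_zero] at h2
    rw [Complex.sub_im, h2.resolve_left hA]
    simp only [hG₀]
    ring
  set κ := α + conj β with hκ
  -- Since Re G₀ = Re(κ e^(iφ)), the polar form of κ gives the amplitude and phase shift. If κ = 0,
  -- then α = conj β makes both coefficients zero, and with them the bracket limits.
  refine ⟨‖κ‖, -κ.arg, ?_, ?_⟩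
  · have hre : (fun x => (G x - G₀ x).re) =O[atTop] fun x : ℝ => x ^ (-(7 / 2) : ℝ) :=
      (IsBigO.of_bound 1 (Eventually.of_forall fun x => by
        rw [one_mul]
        exact Complex.abs_re_le_norm _)).trans hdiff
    refine (rpow_mul_P0_isBigO lam hre).congr' ?_ EventuallyEq.rfl
    filter_upwards [hUG, eventually_gt_atTop 0] with x hx hx0
    have h1 := congrArg Complex.re hx
    rw [Complex.re_ofReal_mul, Complex.ofReal_re] at h1
    have h2 : (G₀ x).re = ‖κ‖ * Real.cos (realPhase lam x - -κ.arg) := by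
      simp only [hG₀]
      rw [re_mul_exp_add, ← hκ]
      nth_rewrite 1 [← Complex.norm_mul_exp_arg_mul_I κ]
      rw [mul_assoc, ← Complex.exp_add, Complex.re_ofReal_mul]
      congr 1
      rw [show (κ.arg : ℂ) * Complex.I + Complex.I * (realPhase lam x : ℂ) =
        ((realPhase lam x - -κ.arg : ℝ) : ℂ) * Complex.I by push_cast; ring,
        Complex.exp_ofReal_mul_I_re]
    rw [yVar, h1, yVar_amplitude hx0, Complex.sub_re, h2, realPhase]
    ring
  · rintro ⟨x, hx, hux⟩ hC
    have hκ0 : α + conj β = 0 := norm_eq_zero.1 hC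
    have hα : α = 0 := by
      have : (2 : ℂ) * α = 0 := by linear_combination hκ0 + hαβ
      simpa using this
    have hβ0 : β = 0 := by
      rw [hα] at hαβ
      simpa using hαβ.symm
    have hla : la = 0 := by
      simpa [hk0] using div_eq_zero_iff.1 hα
    have hlb : lb = 0 := by
      rw [hβ] at hβ0
      simpa [hk0] using hβ0
    exact hux (by simpa [U] using (h0 hla hlb x hx).1)

end ChandrasekharODE

theorem mainTheorem2 :
    (∀ lam : ℂ, lam ≠ 0 →
      ∃ uPlus uMinus : ℝ → ℂ,
        ChandrasekharODE.IsSolution lam 0 uPlus ∧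
        ChandrasekharODE.IsSolution lam 0 uMinus ∧
        LinearIndependent ℂ
          ![(Set.Ioi (0 : ℝ)).domRestrict uPlus, (Set.Ioi (0 : ℝ)).domRestrict uMinus] ∧
        ChandrasekharODE.HasModeForm lam 1 uPlus ∧
        ChandrasekharODE.HasModeForm lam (-1) uMinus) ∧
    (∀ lam : ℝ, 0 < lam → ∀ R : ℝ, 0 ≤ R → ∀ u : ℝ → ℝ,
      ChandrasekharODE.IsSolution lam R u →
      ∃ C θ : ℝ,
        ChandrasekharODE.HasCosForm lam C θ (ChandrasekharODE.yVar u) ∧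
        ((∃ x : ℝ, R < x ∧ u x ≠ 0) → C ≠ 0) ∧
        ∀ C' θ' : ℝ, ChandrasekharODE.HasCosForm lam C' θ' (ChandrasekharODE.yVar u) →
          C' * Real.cos θ' = C * Real.cos θ ∧ C' * Real.sin θ' = C * Real.sin θ) := by
  refine ⟨fun lam hlam => ?_, fun lam hlam R hR u hu => ?_⟩
  · obtain ⟨u, f, v, g, hu, hv, hmu, hmv, hind⟩ := ChandrasekharODE.exists_modes hlam
    refine ⟨u, v, hu.isSolution le_rfl, hv.isSolution le_rfl, ?_, hmu, hmv⟩
    rw [LinearIndependent.pair_iff]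
    intro c₁ c₂ h
    refine hind c₁ c₂ ?_
    filter_upwards [eventually_gt_atTop 0] with x hx
    exact congrFun h ⟨x, hx⟩
  · obtain ⟨C, θ, h, hC⟩ := ChandrasekharODE.exists_hasCosForm hlam hR hu
    exact ⟨C, θ, h, hC, fun C' θ' h' => h.unique hlam h'⟩
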